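/- We work in the synchronous message-passing model: the network is an (unweighted, undirected, simple) $n$-vertex graph $G=(V,E)$ whose vertices have distinct identifiers from $\{1,\dots,n\}$ and private independent random seeds, each uniform on a finite set whose size depends only on $n,t,k$ (and on the algorithm); every vertex initially knows $n$, $t$, $k$, its own identifier and its seed. In every round each vertex may send a message of arbitrary size to its neighbours; local computation is free, and the running time is the number of rounds until all vertices terminate. A subgraph $G'=(V,H)$, $H\subseteq E$, is a $t$-spanner of $G$ if $\mathrm{dist}_{G'}(u,v)\le t\cdot \mathrm{dist}_G(u,v)$ for all $u,v\in V$; the minimum $t$-spanner problem asks for a $t$-spanner with as few edges as possible. A distributed algorithm computes $H$ if on termination every vertex knows which of its incident edges belong to $H$. Theorem. For every constant $c\in\mathbb{N}$ there are constants $a,b,d>0$ and a randomized distributed algorithm such that for all positive integers $n,t,k$ the algorithm, run with parameters $n,t,k$, terminates within $e^{ak}+bt$ (that is, $\exp\{O(k)\}+O(t)$) rounds, and on every $n$-vertex graph $G$ and every assignment of identifiers it computes, with probability at least $1-n^{-c}$, a $t$-spanner of $G$ whose number of edges is at most $d\cdot n^{1/k}$ times the number of edges of a minimum $t$-spanner of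 $G$ (that is, an $O(n^{1/k})$-approximation of the minimum $t$-spanner). -/

import Mathlib

/-- `H` is a `t`-spanner of the unweighted graph `G`: a subgraph of `G` on the same vertex set
with `dist_H(u,v) ≤ t * dist_G(u,v)` for all vertices `u`, `v`. Distances take values in `ℕ∞`,
the distance between vertices in different components being `⊤`. -/
def IsSpanner {V : Type} (t : ℕ) (G H : SimpleGraph V) : Prop :=
  H ≤ G ∧ ∀ u v : V, H.edist u v ≤ (t : ℕ∞) * G.edist u v

/-- `H` is an `α`-approximate solution of the minimum `t`-spanner problem on `G`: it is a
`t`-spanner of `G`, and its number of edges is at most `α` times the number of edges of every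
`t`-spanner of `G` (equivalently, of a minimum one). -/
def IsApproxMinSpanner {V : Type} (t : ℕ) (α : ℝ) (G H : SimpleGraph V) : Prop :=
  IsSpanner t G H ∧
    ∀ H' : SimpleGraph V, IsSpanner t G H' →
      (H.edgeSet.ncard : ℝ) ≤ α * (H'.edgeSet.ncard : ℝ)

/-- The numbers that every vertex is given at the start: the number `n` of vertices of the
network, the stretch `t` and the trade-off parameter `k`. -/
structure SpannerParams where
  n : ℕ
  t : ℕ
  k : ℕ

/-- A randomized algorithm in the synchronous message-passing model with free local computation
and messages of unbounded size, whose vertices all know a common parameter of type `P`.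
All vertices execute the same code. In every round a vertex sends a message to all its neighbours
(as messages are unbounded, one message may contain different parts for different neighbours)
and then updates its state from the messages it receives, each of which comes with the
identifier of its sender. The local output of a vertex is a set of identifiers. -/
structure DistributedAlgorithm (P : Type) where
  /-- local states of a vertex -/
  State : Type
  /-- messages -/
  Msg : Type
  /-- each vertex has a private random seed, uniform in a set of this size -/
  numSeeds : P → ℕ
  numSeeds_pos : ∀ p, 0 < numSeeds p
  /-- number of rounds after which all vertices terminate -/
  rounds : P → ℕ
  /-- initial state, from the parameter, the identifier of the vertex and its random seed -/
  init : (p : P) → ℕ → Fin (numSeeds p) → State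
  /-- the message that a vertex sends to its neighbours in a round -/
  send : State → Msg
  /-- new state, from the old state and the pairs (identifier of the neighbour, its message) -/
  receive : State → Set (ℕ × Msg) → State
  /-- local output upon termination -/
  output : State → Set ℕ

namespace DistributedAlgorithm

variable {P : Type} (A : DistributedAlgorithm P) (p : P) {V : Type} (G : SimpleGraph V)
  (ident : V → ℕ)

/-- The state of every vertex after a number of rounds, when the vertices have the identifiers
`ident` and the random seeds `ω`. -/
def stateAfter (ω : V → Fin (A.numSeeds p)) : ℕ → V → A.State
  | 0, v => A.init p (ident v) (ω v)
  | r + 1, v =>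
      A.receive (stateAfter ω r v)
        {m | ∃ u : V, G.Adj v u ∧ m = (ident u, A.send (stateAfter ω r u))}

/-- The local output of a vertex at the end of the execution with random seeds `ω`. -/
def result (ω : V → Fin (A.numSeeds p)) (v : V) : Set ℕ :=
  A.output (A.stateAfter p G ident ω (A.rounds p) v)

/-- The execution with random seeds `ω` computes the graph `H`: the local output of every vertex
is exactly the set of identifiers of its neighbours in `H`. -/
def Computes (ω : V → Fin (A.numSeeds p)) (H : SimpleGraph V) : Prop :=
  ∀ v : V, A.result p G ident ω v = {i | ∃ u : V, H.Adj v u ∧ ident u = i}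

/-- The probability that the algorithm computes a graph with the property `Q`, when the seeds of
the vertices are independent and uniform. -/
noncomputable def successProb (Q : SimpleGraph V → Prop) : ℝ :=
  (Set.ncard {ω : V → Fin (A.numSeeds p) | ∃ H : SimpleGraph V,
      A.Computes p G ident ω H ∧ Q H} : ℝ) /
    (Nat.card (V → Fin (A.numSeeds p)) : ℝ)

end DistributedAlgorithm

/-! Random clusterings reduce the problem to exact local optimisation. Each vertex `u` draws a
truncated geometric radius `r u`, and a vertex `x` joins the centre that strictly maximises `g * r u
- dist u x`. With `g = 2 * pad + 1`, one extra unit of radius outweighs any change of the comparison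
inside a ball of radius `pad`. By memorylessness, a given ball lies in a single cluster with
probability at least `p - n * p ^ R`, where `p` is the ratio and `R` the truncation (`card_winsBy`,
`card_not_winsBy`). About `n ^ (1/k)` independent copies leave every ball padded in some copy,
except with probability `n ^ (-c)` (`card_padded_ge`, `exists_suitableRatio`).

In each cluster of each copy, a cheapest subgraph stretching the padded edges by at most `t` is
computed. The union stretches every edge, hence every distance, by at most `t`
(`edist_clusterSpanner_le`). For the size, clusters of one copy are disjoint, so it suffices to
exhibit one graph whose restrictions to the clusters are all feasible. If `t < 6 * R`, take `pad =
t`: detours of padded edges in an optimal spanner stay inside the cluster, so the optimal spanner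
itself serves. If `t ≥ 6 * R`, take `pad = 1`: cluster diameters are at most `t`, so shortest-path
trees serve, and they have at most one edge per non-isolated vertex, hence at most twice the optimum
(`ncard_clusterSpanner_le_mul`).

All of this is determined by a neighbourhood of radius `O(pad * R)`
(`LocallyEqual.clusterSpanner_adj_iff`), which vertices collect by flooding. Since `pad < 6 * R` and
`R = exp(O(k))`, the number of rounds is `exp(O(k))`, even without a term in `t`. -/

open SimpleGraph

/-! ### Distances in graphs -/

section Distances

variable {W : Type*}

lemma edist_le_succ_iff (Γ : SimpleGraph W) (v x : W) (m : ℕ) :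
    Γ.edist v x ≤ ((m + 1 : ℕ) : ℕ∞) ↔
      Γ.edist v x ≤ (m : ℕ∞) ∨ ∃ y, Γ.edist v y ≤ (m : ℕ∞) ∧ Γ.Adj y x := by
  constructor
  · intro h
    obtain ⟨p, hp⟩ := Γ.exists_walk_of_edist_ne_top (ne_top_of_le_ne_top (by simp) h)
    rw [← Γ.edist_comm] at hp ⊢
    obtain ⟨q, hq⟩ : ∃ q : Γ.Walk x v, q.length = p.length := ⟨p.reverse, by simp⟩
    rw [Γ.edist_comm, ← hp] at h
    have hl : q.length ≤ m + 1 := by rw [hq]; exact_mod_cast h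
    cases q with
    | nil => left; simp
    | cons hadj q' =>
      right
      refine ⟨_, ?_, hadj.symm⟩
      rw [Γ.edist_comm]
      refine (edist_le q').trans ?_
      simp only [Walk.length_cons] at hl
      exact_mod_cast (by omega : q'.length ≤ m)
  · rintro (h | ⟨y, h, hy⟩)
    · exact h.trans (by exact_mod_cast Nat.le_succ m)
    · refine (Γ.edist_triangle (v := y)).trans ?_
      push_cast
      exact add_le_add h (edist_eq_one_iff_adj.2 hy).le

/-- If every edge of `Γ` is stretched by at most `t`, every distance is. -/
lemma edist_le_mul_of_adj {Γ F : SimpleGraph W} {t : ℕ}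
    (h : ∀ x y, Γ.Adj x y → F.edist x y ≤ (t : ℕ∞)) (ht : 1 ≤ t) (x y : W) :
    F.edist x y ≤ (t : ℕ∞) * Γ.edist x y := by
  by_cases hr : Γ.Reachable x y
  · obtain ⟨p, hp⟩ := hr.exists_walk_length_eq_edist
    rw [← hp]
    clear hp hr
    induction p with
    | nil => simp
    | @cons a b c hadj q ih =>
      refine (F.edist_triangle (v := b)).trans ?_
      rw [Walk.length_cons]
      push_cast
      rw [mul_add, mul_one, add_comm]
      exact add_le_add ih (h _ _ hadj)
  · rw [edist_eq_top_of_not_reachable hr, ENat.mul_top (by exact_mod_cast (by omega))]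
    exact le_top

/-- The subgraph of `Γ` formed by the edges with both ends in `C`. -/
def SimpleGraph.within (Γ : SimpleGraph W) (C : Set W) : SimpleGraph W where
  Adj x y := Γ.Adj x y ∧ x ∈ C ∧ y ∈ C
  symm := ⟨fun _ _ h => ⟨h.1.symm, h.2.2, h.2.1⟩⟩
  loopless := ⟨fun _ h => Γ.loopless.irrefl _ h.1⟩

lemma within_le (Γ : SimpleGraph W) (C : Set W) : Γ.within C ≤ Γ := fun _ _ h => h.1

lemma within_mono {Γ Γ' : SimpleGraph W} (h : Γ ≤ Γ') (C : Set W) : Γ.within C ≤ Γ'.within C :=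
  fun _ _ hxy => ⟨h hxy.1, hxy.2⟩

/-- A short path that starts in the middle of a ball contained in `C` stays in `C`. -/
lemma edist_within_le {Γ H : SimpleGraph W} (hH : H ≤ Γ) {C : Set W} {x : W} {s : ℕ}
    (hC : ∀ y, Γ.edist x y ≤ (s : ℕ∞) → y ∈ C) {m : ℕ} (hm : m ≤ s) {y : W}
    (h : H.edist x y ≤ (m : ℕ∞)) : (H.within C).edist x y ≤ (m : ℕ∞) := by
  induction m generalizing y with
  | zero =>
    have : x = y := by simpa using h
    subst this; simp
  | succ m ih =>
    rw [edist_le_succ_iff] at h ⊢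
    rcases h with h | ⟨z, h, hz⟩
    · exact Or.inl (ih (by omega) h)
    · refine Or.inr ⟨z, ih (by omega) h, hz, hC _ ?_, hC _ ?_⟩
      · exact ((edist_anti hH).trans h).trans (by exact_mod_cast (by omega))
      · have : H.edist x y ≤ ((m + 1 : ℕ) : ℕ∞) := (edist_le_succ_iff ..).2 (Or.inr ⟨z, h, hz⟩)
        exact ((edist_anti hH).trans this).trans (by exact_mod_cast hm)

end Distances

/-! ### Clusters of shifted shortest distances -/

section Clusters

variable {W : Type*} (Γ : SimpleGraph W) (g : ℕ) (r : W → ℕ)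

/-- The cluster of the centre `u`: the vertices at which `g * r u - dist u` is strictly larger
than the corresponding quantity of every other centre. -/
def cluster (u : W) : Set W :=
  {x | ∀ w, w ≠ u → ((g * r w : ℕ) : ℕ∞) + Γ.edist u x < ((g * r u : ℕ) : ℕ∞) + Γ.edist w x}

variable {Γ g r}

lemma edist_le_of_mem_cluster {u x : W} (h : x ∈ cluster Γ g r u) :
    Γ.edist u x ≤ ((g * r u : ℕ) : ℕ∞) := by
  by_cases hx : x = u
  · subst hx; simp
  · have := h x hx
    rw [edist_self, add_zero] at this
    exact le_add_self.trans this.le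

lemma cluster_disjoint {u w x : W} (hu : x ∈ cluster Γ g r u) (hw : x ∈ cluster Γ g r w) :
    u = w := by
  by_contra hne
  exact lt_asymm (hu w (Ne.symm hne)) (hw u hne)

/-- Every vertex of a cluster other than the centre has a neighbour in the cluster that is
closer to the centre. -/
lemma exists_parent {u x : W} (hx : x ∈ cluster Γ g r u) (hne : x ≠ u) :
    ∃ y, Γ.Adj y x ∧ y ∈ cluster Γ g r u ∧ Γ.edist u y + 1 = Γ.edist u x := by
  have hle := edist_le_of_mem_cluster hx
  have hfin : Γ.edist u x ≠ ⊤ := ne_top_of_le_ne_top (ENat.natCast_ne_top _) hle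
  obtain ⟨d, hd⟩ := ENat.ne_top_iff_exists.1 hfin
  have hd0 : d ≠ 0 := by
    rintro rfl
    exact hne (by simpa using hd.symm : u = x).symm
  obtain ⟨m, rfl⟩ := Nat.exists_eq_succ_of_ne_zero hd0
  have h1 : Γ.edist u x ≤ ((m + 1 : ℕ) : ℕ∞) := hd.symm.le
  rw [edist_le_succ_iff] at h1
  rcases h1 with h1 | ⟨y, hy, hadj⟩
  · rw [← hd] at h1
    exact absurd (by exact_mod_cast h1 : m + 1 ≤ m) (by omega)
  have hxy : Γ.edist u x ≤ Γ.edist u y + 1 :=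
    Γ.edist_triangle.trans (add_le_add le_rfl (edist_eq_one_iff_adj.2 hadj).le)
  have heq : Γ.edist u y + 1 = Γ.edist u x := by
    refine le_antisymm ?_ hxy
    rw [← hd]; push_cast
    exact add_le_add hy le_rfl
  -- Stepping from `x` to `y` lowers the distance to `u` by exactly one and every other distance by
  -- at most one, so `u` still wins at `y`.
  refine ⟨y, hadj, fun w hw => ?_, heq⟩
  have h2 := hx w hw
  have h3 : Γ.edist w x ≤ Γ.edist w y + 1 :=
    Γ.edist_triangle.trans (add_le_add le_rfl (edist_eq_one_iff_adj.2 hadj).le)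
  rw [← heq, ← add_assoc] at h2
  have h4 := h2.trans_le (add_le_add le_rfl h3)
  rw [← add_assoc] at h4
  exact lt_of_add_lt_add_right h4

/-- If the centre `u` wins at `v` by a margin of `2 * s + 1`, it wins on the ball of radius `s`
around `v`. -/
lemma ball_subset_cluster {u v : W} {s : ℕ} (hu : Γ.edist u v ≠ ⊤)
    (h : ∀ w, w ≠ u → ((g * r w : ℕ) : ℕ∞) + Γ.edist u v + ((2 * s + 1 : ℕ) : ℕ∞) ≤
      ((g * r u : ℕ) : ℕ∞) + Γ.edist w v)
    {y : W} (hy : Γ.edist v y ≤ (s : ℕ∞)) : y ∈ cluster Γ g r u := by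
  intro w hw
  have h1 := h w hw
  have h2 : Γ.edist u y ≤ Γ.edist u v + s := Γ.edist_triangle.trans (add_le_add le_rfl hy)
  have h3 : Γ.edist w v ≤ Γ.edist w y + s :=
    Γ.edist_triangle.trans (add_le_add le_rfl (by rwa [Γ.edist_comm]))
  generalize Γ.edist u v = a at *
  generalize Γ.edist u y = b at *
  generalize Γ.edist w v = c at *
  generalize Γ.edist w y = d at *
  lift a to ℕ using hu
  by_cases hd : d = ⊤
  · subst hd
    rw [add_top]
    exact lt_top_iff_ne_top.2 (WithTop.add_ne_top.2 ⟨ENat.natCast_ne_top _,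
      ne_top_of_le_ne_top (WithTop.add_ne_top.2 ⟨ENat.natCast_ne_top _, ENat.natCast_ne_top _⟩) h2⟩)
  lift d to ℕ using hd
  lift b to ℕ using ne_top_of_le_ne_top (by simp) h2
  lift c to ℕ using ne_top_of_le_ne_top (by simp) h3
  norm_cast at *
  omega

/-- A centre farther than `g * R` has a negative shifted value, while the winner's is nonnegative.
Membership therefore depends only on the ball of radius `g * R` around `x`, which is the source of
locality. -/
lemma mem_cluster_iff_of_le {R : ℕ} (hr : ∀ x, r x ≤ R) {u x : W} :
    x ∈ cluster Γ g r u ↔ Γ.edist x u ≤ ((g * R : ℕ) : ℕ∞) ∧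
      ∀ w, w ≠ u → Γ.edist x w ≤ ((g * R : ℕ) : ℕ∞) →
        ((g * r w : ℕ) : ℕ∞) + Γ.edist x u < ((g * r u : ℕ) : ℕ∞) + Γ.edist x w := by
  constructor
  · intro h
    refine ⟨?_, fun w hw _ => ?_⟩
    · rw [Γ.edist_comm]
      exact (edist_le_of_mem_cluster h).trans (by exact_mod_cast Nat.mul_le_mul_left g (hr u))
    · rw [Γ.edist_comm, Γ.edist_comm (u := x)]
      exact h w hw
  · rintro ⟨hu, h⟩
    have hux : Γ.edist x u ≤ ((g * r u : ℕ) : ℕ∞) := by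
      by_cases hx : x = u
      · subst hx; simp
      · have := h x hx (by simp)
        rw [edist_self, add_zero] at this
        exact le_add_self.trans this.le
    intro w hw
    rw [Γ.edist_comm (v := x), Γ.edist_comm (v := x)]
    by_cases hwx : Γ.edist x w ≤ ((g * R : ℕ) : ℕ∞)
    · exact h w hw hwx
    · rw [not_le] at hwx
      have h1 : ((g * r w : ℕ) : ℕ∞) ≤ ((g * R : ℕ) : ℕ∞) := by
        exact_mod_cast Nat.mul_le_mul_left g (hr w)
      calc ((g * r w : ℕ) : ℕ∞) + Γ.edist x u
          ≤ ((g * R : ℕ) : ℕ∞) + ((g * r u : ℕ) : ℕ∞) := add_le_add h1 hux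
        _ = ((g * r u : ℕ) : ℕ∞) + ((g * R : ℕ) : ℕ∞) := add_comm _ _
        _ < _ := by
          refine (ENat.add_lt_add_iff_left (ENat.natCast_ne_top _)).2 hwx

end Clusters

/-! ### Optimal local spanners and their union -/

section ClusterSpanner

variable {W : Type*}

/-- The subgraphs of `E` that stretch the pairs in `D` by at most `t`. -/
def feasible (E : SimpleGraph W) (D : W → W → Prop) (t : ℕ) : Set (SimpleGraph W) :=
  {F | F ≤ E ∧ ∀ x y, D x y → F.edist x y ≤ (t : ℕ∞)}

open Classical in
/-- A subgraph of `E` with the least number of edges among those that stretch the pairs in `D`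
by at most `t`. -/
noncomputable def optimalSubgraph (E : SimpleGraph W) (D : W → W → Prop) (t : ℕ) :
    SimpleGraph W :=
  if h : (feasible E D t).Nonempty then
    Function.argminOn (fun F : SimpleGraph W => F.edgeSet.ncard) (feasible E D t) h
  else ⊥

lemma optimalSubgraph_le (E : SimpleGraph W) (D : W → W → Prop) (t : ℕ) :
    optimalSubgraph E D t ≤ E := by
  unfold optimalSubgraph
  split_ifs with h
  · exact (Function.argminOn_mem _ _ h).1
  · exact bot_le

lemma edist_optimalSubgraph_le {E : SimpleGraph W} {D : W → W → Prop} {t : ℕ}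
    (h : (feasible E D t).Nonempty) {x y : W} (hxy : D x y) :
    (optimalSubgraph E D t).edist x y ≤ (t : ℕ∞) := by
  unfold optimalSubgraph
  rw [dif_pos h]
  exact (Function.argminOn_mem _ _ h).2 x y hxy

lemma ncard_optimalSubgraph_le {E F : SimpleGraph W} {D : W → W → Prop} {t : ℕ}
    (h : F ∈ feasible E D t) :
    (optimalSubgraph E D t).edgeSet.ncard ≤ F.edgeSet.ncard := by
  unfold optimalSubgraph
  rw [dif_pos ⟨F, h⟩]
  exact Function.argminOn_le (fun F : SimpleGraph W => F.edgeSet.ncard) _ h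

/-- The parameters of the construction: the number of copies of the clustering, the stretch, and
the radius of the balls to be contained in clusters. -/
structure ClusterParams where
  copies : ℕ
  stretch : ℕ
  pad : ℕ

/-- The factor by which the radii are scaled. -/
def ClusterParams.gap (q : ClusterParams) : ℕ := 2 * q.pad + 1

variable (q : ClusterParams) (Γ : SimpleGraph W) (ρ : W → ℕ → ℕ)

/-- The cluster of `u` in the copy `i`. -/
def copyCluster (i : ℕ) (u : W) : Set W := cluster Γ q.gap (fun x => ρ x i) u

/-- The edges that the cluster of `u` in the copy `i` has to span: those with an end whose ball
of radius `pad` is contained in the cluster. -/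
def demand (i : ℕ) (u : W) (x y : W) : Prop :=
  Γ.Adj x y ∧ ∀ z, Γ.edist x z ≤ (q.pad : ℕ∞) → z ∈ copyCluster q Γ ρ i u

/-- The optimal subgraph of the cluster of `u` in the copy `i`. -/
noncomputable def localSpanner (i : ℕ) (u : W) : SimpleGraph W :=
  optimalSubgraph (Γ.within (copyCluster q Γ ρ i u)) (demand q Γ ρ i u) q.stretch

/-- The union of the optimal subgraphs of all clusters with centres in `U`. -/
noncomputable def clusterSpanner (U : Finset W) : SimpleGraph W where
  Adj x y := ∃ i < q.copies, ∃ u ∈ U, (localSpanner q Γ ρ i u).Adj x y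
  symm := ⟨fun _ _ ⟨i, hi, u, hu, h⟩ => ⟨i, hi, u, hu, h.symm⟩⟩
  loopless := ⟨fun _ ⟨_, _, _, _, h⟩ => SimpleGraph.irrefl _ h⟩

variable {q Γ ρ}

lemma localSpanner_le_within (i : ℕ) (u : W) :
    localSpanner q Γ ρ i u ≤ Γ.within (copyCluster q Γ ρ i u) := optimalSubgraph_le _ _ _

lemma clusterSpanner_le (U : Finset W) : clusterSpanner q Γ ρ U ≤ Γ := by
  rintro x y ⟨i, -, u, -, h⟩
  exact (localSpanner_le_within i u h).1

lemma localSpanner_le_clusterSpanner {U : Finset W} {i : ℕ} (hi : i < q.copies) {u : W}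
    (hu : u ∈ U) : localSpanner q Γ ρ i u ≤ clusterSpanner q Γ ρ U :=
  fun _ _ h => ⟨i, hi, u, hu, h⟩

/-- Rules out the default value `⊥` of `optimalSubgraph`: a demanded edge has both ends in the
cluster, since `pad` is at least one. -/
lemma within_mem_feasible (hs : 1 ≤ q.pad) (ht : 1 ≤ q.stretch) (i : ℕ) (u : W) :
    Γ.within (copyCluster q Γ ρ i u) ∈
      feasible (Γ.within (copyCluster q Γ ρ i u)) (demand q Γ ρ i u) q.stretch := by
  refine ⟨le_rfl, fun x y h => ?_⟩
  have hadj : (Γ.within (copyCluster q Γ ρ i u)).Adj x y := by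
    refine ⟨h.1, h.2 _ (by simp), h.2 _ ?_⟩
    exact (edist_eq_one_iff_adj.2 h.1).le.trans (by exact_mod_cast hs)
  exact (edist_eq_one_iff_adj.2 hadj).le.trans (by exact_mod_cast ht)

/-- If every vertex is padded in some copy, the union of the local spanners is a spanner. -/
lemma edist_clusterSpanner_le (hs : 1 ≤ q.pad) (ht : 1 ≤ q.stretch) {U : Finset W}
    (hpad : ∀ x y, Γ.Adj x y → ∃ i < q.copies, ∃ u ∈ U,
      ∀ z, Γ.edist x z ≤ (q.pad : ℕ∞) → z ∈ copyCluster q Γ ρ i u) (x y : W) :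
    (clusterSpanner q Γ ρ U).edist x y ≤ (q.stretch : ℕ∞) * Γ.edist x y := by
  refine edist_le_mul_of_adj (fun x y hxy => ?_) ht x y
  obtain ⟨i, hi, u, hu, h⟩ := hpad x y hxy
  exact (edist_anti (localSpanner_le_clusterSpanner hi hu)).trans
    (edist_optimalSubgraph_le ⟨_, within_mem_feasible hs ht i u⟩ ⟨hxy, h⟩)

end ClusterSpanner

/-! ### The number of edges of the union of the local spanners -/

section Size

variable {W : Type*}

lemma sum_ncard_within_le {ι : Type*} {F : SimpleGraph W} (hF : F.edgeSet.Finite) (U : Finset ι)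
    (C : ι → Set W) (hC : ∀ u w x, x ∈ C u → x ∈ C w → u = w) :
    ∑ u ∈ U, (F.within (C u)).edgeSet.ncard ≤ F.edgeSet.ncard := by
  have hsub : ∀ u, (F.within (C u)).edgeSet ⊆ F.edgeSet := fun u =>
    edgeSet_subset_edgeSet.2 (within_le F (C u))
  have h := U.finite_toSet.ncard_biUnion (s := fun u => (F.within (C u)).edgeSet)
    (fun u _ => hF.subset (hsub u)) (by
      intro u _ w _ hne
      refine Set.disjoint_left.2 fun e he hw => hne ?_
      induction e with
      | h x y => exact hC u w x he.2.1 hw.2.1)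
  rw [finsum_mem_coe_finset] at h
  rw [← h]
  exact Set.ncard_le_ncard (Set.iUnion₂_subset fun u _ => hsub u) hF

variable {q : ClusterParams} {Γ : SimpleGraph W} {ρ : W → ℕ → ℕ}

lemma copyCluster_disjoint {i : ℕ} {u w x : W} (hu : x ∈ copyCluster q Γ ρ i u)
    (hw : x ∈ copyCluster q Γ ρ i w) : u = w := cluster_disjoint hu hw

/-- Each local optimum costs at most the restriction of `F` to its cluster, and these restrictions
are edge-disjoint within a copy. The witness `F` may change from copy to copy. -/
lemma ncard_clusterSpanner_le (U : Finset W) (m : ℕ)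
    (h : ∀ i < q.copies, ∃ F : SimpleGraph W, F.edgeSet.Finite ∧ F.edgeSet.ncard ≤ m ∧
      ∀ u ∈ U, F.within (copyCluster q Γ ρ i u) ∈
        feasible (Γ.within (copyCluster q Γ ρ i u)) (demand q Γ ρ i u) q.stretch)
    (hΓ : Γ.edgeSet.Finite) :
    (clusterSpanner q Γ ρ U).edgeSet.ncard ≤ q.copies * m := by
  have hfin : ∀ i u, (localSpanner q Γ ρ i u).edgeSet.Finite := fun i u =>
    hΓ.subset (edgeSet_subset_edgeSet.2 ((localSpanner_le_within i u).trans (within_le _ _)))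
  have hsub : (clusterSpanner q Γ ρ U).edgeSet ⊆
      ⋃ i ∈ Finset.range q.copies, ⋃ u ∈ U, (localSpanner q Γ ρ i u).edgeSet := by
    intro e he
    induction e with
    | h x y =>
      obtain ⟨i, hi, u, hu, h⟩ := he
      simp only [Set.mem_iUnion]
      exact ⟨i, Finset.mem_range.2 hi, u, hu, h⟩
  refine (Set.ncard_le_ncard hsub ?_).trans ?_
  · exact Set.Finite.biUnion (Finset.finite_toSet _) fun i _ =>
      Set.Finite.biUnion (Finset.finite_toSet _) fun u _ => hfin i u
  refine (Finset.set_ncard_biUnion_le _ _).trans ?_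
  refine (Finset.sum_le_card_nsmul _ _ m fun i hi => ?_).trans (by simp)
  obtain ⟨F, hF, hm, hu⟩ := h i (Finset.mem_range.1 hi)
  refine (Finset.set_ncard_biUnion_le _ _).trans (le_trans ?_ hm)
  refine le_trans (Finset.sum_le_sum fun u hU => ncard_optimalSubgraph_le (hu u hU)) ?_
  exact sum_ncard_within_le hF U _ fun u w x => copyCluster_disjoint

/-- A detour of length at most `stretch ≤ pad` from the padded end of an edge cannot leave the
padded ball, hence stays in the cluster. -/
lemma spanner_within_mem_feasible {H : SimpleGraph W} (hH : H ≤ Γ)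
    (hst : ∀ x y, H.edist x y ≤ (q.stretch : ℕ∞) * Γ.edist x y) (hs : q.stretch ≤ q.pad)
    (i : ℕ) (u : W) :
    H.within (copyCluster q Γ ρ i u) ∈
      feasible (Γ.within (copyCluster q Γ ρ i u)) (demand q Γ ρ i u) q.stretch := by
  refine ⟨within_mono hH _, fun x y h => edist_within_le hH h.2 hs ?_⟩
  have := hst x y
  rwa [edist_eq_one_iff_adj.2 h.1, mul_one] at this

/-- A forest of shortest paths from the vertices of the clusters to their centres. -/
lemma exists_clusterForest (hΓ : Γ.edgeSet.Finite) {R : ℕ} (hρ : ∀ x i, ρ x i ≤ R)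
    (hs : 1 ≤ q.pad) (hR : 2 * (q.gap * R) ≤ q.stretch) (i : ℕ) :
    ∃ F : SimpleGraph W, F.edgeSet.Finite ∧ F.edgeSet.ncard ≤ Γ.support.ncard ∧
      ∀ u, F.within (copyCluster q Γ ρ i u) ∈
        feasible (Γ.within (copyCluster q Γ ρ i u)) (demand q Γ ρ i u) q.stretch := by
  -- The parent can be chosen independently of `u` because clusters are disjoint. Hence `F` has at
  -- most one edge per non-isolated vertex, over all clusters together.
  have hpar : ∀ x, ∃ y, ∀ u, x ∈ copyCluster q Γ ρ i u → x ≠ u →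
      Γ.Adj y x ∧ y ∈ copyCluster q Γ ρ i u ∧ Γ.edist u y + 1 = Γ.edist u x := by
    intro x
    by_cases h : ∃ u, x ∈ copyCluster q Γ ρ i u ∧ x ≠ u
    · obtain ⟨u, hu, hne⟩ := h
      obtain ⟨y, hy⟩ := exists_parent hu hne
      refine ⟨y, fun w hw _ => ?_⟩
      obtain rfl := copyCluster_disjoint hu hw
      exact hy
    · exact ⟨x, fun u hu hne => absurd ⟨u, hu, hne⟩ h⟩
  choose π hπ using hpar
  have hsupp : Γ.support.Finite := by
    refine (hΓ.biUnion (t := fun e => {v | v ∈ e}) fun e _ => ?_).subset fun x hx => ?_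
    · induction e with
      | h a b =>
        refine (Set.toFinite {a, b}).subset fun v hv => ?_
        simpa using hv
    · obtain ⟨y, hy⟩ := hx
      exact Set.mem_biUnion (x := s(x, y)) hy (by simp)
  let F : SimpleGraph W := fromEdgeSet
    {e | ∃ x u, x ∈ copyCluster q Γ ρ i u ∧ x ≠ u ∧ e = s(π x, x)}
  have hFadj : ∀ x u, x ∈ copyCluster q Γ ρ i u → x ≠ u → F.Adj (π x) x := fun x u hx hne =>
    (fromEdgeSet_adj _).2 ⟨⟨x, u, hx, hne, rfl⟩, (hπ x u hx hne).1.ne⟩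
  have hFΓ : F ≤ Γ := by
    intro a b hab
    obtain ⟨⟨x, u, hx, hne, he⟩, -⟩ := (fromEdgeSet_adj _).1 hab
    have := (hπ x u hx hne).1
    rw [← mem_edgeSet] at this ⊢
    rwa [he]
  have hFsub : F.edgeSet ⊆ (fun x => s(π x, x)) '' Γ.support := by
    intro e he
    rw [edgeSet_fromEdgeSet] at he
    obtain ⟨⟨x, u, hx, hne, rfl⟩, -⟩ := he
    exact ⟨x, ⟨π x, (hπ x u hx hne).1.symm⟩, rfl⟩
  refine ⟨F, (hsupp.image _).subset hFsub, ?_, fun u => ⟨within_mono hFΓ _, fun x y h => ?_⟩⟩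
  · exact (Set.ncard_le_ncard hFsub (hsupp.image _)).trans (Set.ncard_image_le hsupp)
  · have key : ∀ (m : ℕ) (x : W), x ∈ copyCluster q Γ ρ i u → Γ.edist u x ≤ (m : ℕ∞) →
        (F.within (copyCluster q Γ ρ i u)).edist u x ≤ (m : ℕ∞) := by
      intro m
      induction m with
      | zero =>
        intro x _ hd
        have : u = x := by simpa using hd
        subst this; simp
      | succ m ih =>
        intro x hx hd
        by_cases hne : x = u
        · subst hne; simp
        · obtain ⟨h1, h2, h3⟩ := hπ x u hx hne
          refine (edist_le_succ_iff ..).2 (Or.inr ⟨π x, ih _ h2 ?_, hFadj x u hx hne, h2, hx⟩)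
          rw [← h3] at hd
          push_cast at hd
          exact (ENat.add_le_add_iff_right (by simp)).1 hd
    have hrad : ∀ x, x ∈ copyCluster q Γ ρ i u →
        (F.within (copyCluster q Γ ρ i u)).edist u x ≤ ((q.gap * R : ℕ) : ℕ∞) := fun x hx =>
      key _ x hx ((edist_le_of_mem_cluster hx).trans
        (by exact_mod_cast Nat.mul_le_mul_left _ (hρ u i)))
    have hx := hrad x (h.2 x (by simp))
    have hy := hrad y (h.2 y ((edist_eq_one_iff_adj.2 h.1).le.trans (by exact_mod_cast hs)))
    rw [edist_comm] at hx
    refine (SimpleGraph.edist_triangle (v := u)).trans ((add_le_add hx hy).trans ?_)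
    exact_mod_cast (by omega)

/-- Finite stretch forces every non-isolated vertex of `Γ` to have an edge of `H`, and each edge
covers two vertices. -/
lemma support_ncard_le {H : SimpleGraph W} (hΓ : Γ.edgeSet.Finite) (hH : H ≤ Γ) {t : ℕ}
    (hst : ∀ x y, H.edist x y ≤ (t : ℕ∞) * Γ.edist x y) :
    Γ.support.ncard ≤ 2 * H.edgeSet.ncard := by
  have hfin : H.edgeSet.Finite := hΓ.subset (edgeSet_subset_edgeSet.2 hH)
  have hmem : ∀ e : Sym2 W, {v | v ∈ e}.Finite ∧ {v | v ∈ e}.ncard ≤ 2 := by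
    intro e
    induction e with
    | h a b =>
      have : {v | v ∈ s(a, b)} = {a, b} := by ext v; simp
      rw [this]
      exact ⟨Set.toFinite _, (Set.ncard_insert_le a {b}).trans (by simp)⟩
  have hsub : Γ.support ⊆ ⋃ e ∈ hfin.toFinset, {v | v ∈ e} := by
    rintro x ⟨y, hy⟩
    have h := hst x y
    rw [edist_eq_one_iff_adj.2 hy, mul_one] at h
    obtain ⟨p, -⟩ := exists_walk_of_edist_ne_top (ne_top_of_le_ne_top (ENat.natCast_ne_top _) h)
    cases p with
    | nil => exact absurd rfl hy.ne
    | @cons _ b _ hadj _ =>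
      exact Set.mem_biUnion (x := s(x, b)) (by simpa using hadj) (by simp)
  refine (Set.ncard_le_ncard hsub ?_).trans ?_
  · exact Set.Finite.biUnion (Finset.finite_toSet _) fun e _ => (hmem e).1
  refine (Finset.set_ncard_biUnion_le _ _).trans ?_
  refine (Finset.sum_le_card_nsmul _ _ 2 fun e _ => (hmem e).2).trans ?_
  rw [Set.ncard_eq_toFinset_card _ hfin, smul_eq_mul, mul_comm]

/-- The union of the local spanners has at most `2 * copies` times as many edges as any spanner,
if either the clusters are padded to the stretch, or the stretch exceeds their diameter. -/
lemma ncard_clusterSpanner_le_mul (hΓ : Γ.edgeSet.Finite) {R : ℕ} (hρ : ∀ x i, ρ x i ≤ R)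
    (hs : 1 ≤ q.pad) (hR : q.stretch ≤ q.pad ∨ 2 * (q.gap * R) ≤ q.stretch) (U : Finset W)
    {H : SimpleGraph W} (hH : H ≤ Γ)
    (hst : ∀ x y, H.edist x y ≤ (q.stretch : ℕ∞) * Γ.edist x y) :
    (clusterSpanner q Γ ρ U).edgeSet.ncard ≤ q.copies * (2 * H.edgeSet.ncard) := by
  refine ncard_clusterSpanner_le U _ (fun i _ => ?_) hΓ
  rcases hR with hR | hR
  · exact ⟨H, hΓ.subset (edgeSet_subset_edgeSet.2 hH), by omega,
      fun u _ => spanner_within_mem_feasible hH hst hR i u⟩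
  · obtain ⟨F, h1, h2, h3⟩ := exists_clusterForest hΓ hρ hs hR i
    exact ⟨F, h1, h2.trans (support_ncard_le hΓ hH hst), fun u _ => h3 u⟩

end Size

/-! ### Locality -/

section Locality

variable {W : Type*}

/-- Two graphs with vertex labels look the same up to distance `T` from `v`. -/
def LocallyEqual (Γ : SimpleGraph W) (ρ : W → ℕ → ℕ) (Γ' : SimpleGraph W) (ρ' : W → ℕ → ℕ)
    (v : W) (T : ℕ) : Prop :=
  ∀ x, Γ.edist v x ≤ (T : ℕ∞) → ρ x = ρ' x ∧ ∀ y, Γ.Adj x y ↔ Γ'.Adj x y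

variable {Γ Γ' : SimpleGraph W} {ρ ρ' : W → ℕ → ℕ} {v : W} {T : ℕ}

lemma LocallyEqual.edist_le_iff (h : LocallyEqual Γ ρ Γ' ρ' v T) {m : ℕ} (hm : m ≤ T) (x : W) :
    Γ.edist v x ≤ (m : ℕ∞) ↔ Γ'.edist v x ≤ (m : ℕ∞) := by
  induction m generalizing x with
  | zero => simp
  | succ m ih =>
    rw [edist_le_succ_iff, edist_le_succ_iff, ih (by omega)]
    refine or_congr Iff.rfl (exists_congr fun y => ?_)
    rw [ih (by omega)]
    refine and_congr_right fun hy => ?_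
    rw [← ih (by omega)] at hy
    exact (h y (hy.trans (by exact_mod_cast (by omega)))).2 x

lemma LocallyEqual.symm (h : LocallyEqual Γ ρ Γ' ρ' v T) : LocallyEqual Γ' ρ' Γ ρ v T :=
  fun x hx => by
    obtain ⟨h1, h2⟩ := h x ((h.edist_le_iff le_rfl x).2 hx)
    exact ⟨h1.symm, fun y => (h2 y).symm⟩

lemma LocallyEqual.shift {m : ℕ} (h : LocallyEqual Γ ρ Γ' ρ' v (T + m)) {x : W}
    (hx : Γ.edist v x ≤ (m : ℕ∞)) : LocallyEqual Γ ρ Γ' ρ' x T := fun y hy =>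
  h y (Γ.edist_triangle.trans ((add_le_add hx hy).trans (by rw [add_comm]; push_cast; rfl)))

lemma LocallyEqual.mono {m : ℕ} (h : LocallyEqual Γ ρ Γ' ρ' v T) (hm : m ≤ T) :
    LocallyEqual Γ ρ Γ' ρ' v m := fun x hx => h x (hx.trans (by exact_mod_cast hm))

lemma LocallyEqual.edist_eq (h : LocallyEqual Γ ρ Γ' ρ' v T) {x : W}
    (hx : Γ.edist v x ≤ (T : ℕ∞)) : Γ.edist v x = Γ'.edist v x := by
  have hx' := (h.edist_le_iff le_rfl x).1 hx
  obtain ⟨a, ha⟩ := ENat.ne_top_iff_exists.1 (ne_top_of_le_ne_top (ENat.natCast_ne_top _) hx)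
  obtain ⟨b, hb⟩ := ENat.ne_top_iff_exists.1 (ne_top_of_le_ne_top (ENat.natCast_ne_top _) hx')
  rw [← ha] at hx
  rw [← hb] at hx'
  refine le_antisymm ?_ ?_
  · rw [← hb, h.edist_le_iff (by exact_mod_cast hx'), hb]
  · rw [← ha, ← h.edist_le_iff (by exact_mod_cast hx), ha]

variable {q : ClusterParams} {R : ℕ}

lemma LocallyEqual.mem_copyCluster (h : LocallyEqual Γ ρ Γ' ρ' v (q.gap * R))
    (hρ : ∀ x i, ρ x i ≤ R) (hρ' : ∀ x i, ρ' x i ≤ R) {i : ℕ} {u : W}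
    (hv : v ∈ copyCluster q Γ ρ i u) : v ∈ copyCluster q Γ' ρ' i u := by
  unfold copyCluster at *
  rw [mem_cluster_iff_of_le fun x => hρ x i] at hv
  rw [mem_cluster_iff_of_le fun x => hρ' x i]
  refine ⟨(h.edist_le_iff le_rfl u).1 hv.1, fun w hw hwx => ?_⟩
  have hwx' := (h.edist_le_iff le_rfl w).2 hwx
  have := hv.2 w hw hwx'
  rwa [h.edist_eq hv.1, h.edist_eq hwx', (h u hv.1).1, (h w hwx').1] at this

lemma LocallyEqual.edist_center_le (hρ : ∀ x i, ρ x i ≤ R) {i : ℕ} {u x : W}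
    (hx : x ∈ copyCluster q Γ ρ i u) : Γ.edist u x ≤ ((q.gap * R : ℕ) : ℕ∞) :=
  (edist_le_of_mem_cluster hx).trans (by exact_mod_cast Nat.mul_le_mul_left _ (hρ u i))

lemma LocallyEqual.copyCluster_subset {u : W}
    (h : LocallyEqual Γ ρ Γ' ρ' u (q.gap * R + q.gap * R))
    (hρ : ∀ x i, ρ x i ≤ R) (hρ' : ∀ x i, ρ' x i ≤ R) (i : ℕ) :
    copyCluster q Γ ρ i u ⊆ copyCluster q Γ' ρ' i u := fun _ hx =>
  (h.shift (LocallyEqual.edist_center_le hρ hx)).mem_copyCluster hρ hρ' hx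

lemma LocallyEqual.demand_imp {u : W}
    (h : LocallyEqual Γ ρ Γ' ρ' u (q.gap * R + q.pad + q.gap * R))
    (hρ : ∀ x i, ρ x i ≤ R) (hρ' : ∀ x i, ρ' x i ≤ R) {i : ℕ} {x y : W}
    (hd : demand q Γ ρ i u x y) : demand q Γ' ρ' i u x y := by
  have hx : x ∈ copyCluster q Γ ρ i u := hd.2 x (by simp)
  have hl := h.shift (LocallyEqual.edist_center_le hρ hx)
  refine ⟨((hl x (by simp)).2 y).1 hd.1, fun z hz => ?_⟩
  refine (h.mono (by omega)).copyCluster_subset hρ hρ' i (hd.2 z ?_)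
  exact (hl.edist_le_iff (by omega) z).2 hz

/-- Distances add up: `gap * R` from the centre to a member, `pad` for the ball around it, and `gap
* R` more to decide membership there. As `optimalSubgraph` is a fixed function of its arguments,
observers who agree on these data also choose the same optimum. -/
lemma LocallyEqual.localSpanner_eq {u : W}
    (h : LocallyEqual Γ ρ Γ' ρ' u (q.gap * R + q.pad + q.gap * R))
    (hρ : ∀ x i, ρ x i ≤ R) (hρ' : ∀ x i, ρ' x i ≤ R) (i : ℕ) :
    localSpanner q Γ ρ i u = localSpanner q Γ' ρ' i u := by
  have hC : copyCluster q Γ ρ i u = copyCluster q Γ' ρ' i u :=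
    ((h.mono (by omega)).copyCluster_subset hρ hρ' i).antisymm
      ((h.symm.mono (by omega)).copyCluster_subset hρ' hρ i)
  have hD : demand q Γ ρ i u = demand q Γ' ρ' i u := by
    ext x y
    exact ⟨h.demand_imp hρ hρ', h.symm.demand_imp hρ' hρ⟩
  have hE : Γ.within (copyCluster q Γ ρ i u) = Γ'.within (copyCluster q Γ' ρ' i u) := by
    ext x y
    change (_ ∧ _) ↔ (_ ∧ _)
    rw [← hC]
    refine and_congr_left fun hxy => ?_
    exact ((h.shift (LocallyEqual.edist_center_le hρ hxy.1)) x (by simp)).2 y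
  unfold localSpanner
  rw [hD, hE]

lemma LocallyEqual.clusterSpanner_imp
    (h : LocallyEqual Γ ρ Γ' ρ' v (q.gap * R + q.pad + q.gap * R + q.gap * R))
    (hρ : ∀ x i, ρ x i ≤ R) (hρ' : ∀ x i, ρ' x i ≤ R) {U : Finset W} {y : W}
    (hy : (clusterSpanner q Γ ρ U).Adj v y) : (clusterSpanner q Γ' ρ' U).Adj v y := by
  obtain ⟨i, hi, u, hu, hadj⟩ := hy
  have hv : v ∈ copyCluster q Γ ρ i u := (localSpanner_le_within i u hadj).2.1
  refine ⟨i, hi, u, hu, ?_⟩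
  rw [← (h.shift ?_).localSpanner_eq hρ hρ' i]
  · exact hadj
  · rw [Γ.edist_comm]
    exact LocallyEqual.edist_center_le hρ hv

/-- The edges of the union of local spanners at a vertex are determined by the part of the graph
around this vertex. -/
lemma LocallyEqual.clusterSpanner_adj_iff
    (h : LocallyEqual Γ ρ Γ' ρ' v (q.gap * R + q.pad + q.gap * R + q.gap * R))
    (hρ : ∀ x i, ρ x i ≤ R) (hρ' : ∀ x i, ρ' x i ≤ R) (U : Finset W) (y : W) :
    (clusterSpanner q Γ ρ U).Adj v y ↔ (clusterSpanner q Γ' ρ' U).Adj v y :=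
  ⟨h.clusterSpanner_imp hρ hρ', h.symm.clusterSpanner_imp hρ' hρ⟩

end Locality

/-! ### Truncated geometric radii -/

section Radii

/-- The radius read off from a seed: the largest `j ≤ R` such that the seed is among the first
`N ^ (R - j) * M ^ j` of the `N ^ R` seeds. -/
def radiusOfSeed (N M R s : ℕ) : ℕ := Nat.findGreatest (fun j => s < N ^ (R - j) * M ^ j) R

lemma radiusOfSeed_le (N M R s : ℕ) : radiusOfSeed N M R s ≤ R := Nat.findGreatest_le R

lemma le_radiusOfSeed_iff {N M R s j : ℕ} (hMN : M ≤ N) (hs : s < N ^ R) (hj : j ≤ R) :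
    j ≤ radiusOfSeed N M R s ↔ s < N ^ (R - j) * M ^ j := by
  constructor
  · intro h
    have hR := radiusOfSeed_le N M R s
    have hspec : s < N ^ (R - radiusOfSeed N M R s) * M ^ radiusOfSeed N M R s :=
      Nat.findGreatest_spec (P := fun j => s < N ^ (R - j) * M ^ j) (Nat.zero_le R) (by simpa)
    refine hspec.trans_le ?_
    generalize radiusOfSeed N M R s = m at *
    obtain ⟨a, rfl⟩ := Nat.exists_eq_add_of_le h
    obtain ⟨b, rfl⟩ := Nat.exists_eq_add_of_le hR
    rw [show j + a + b - (j + a) = b by omega, show j + a + b - j = b + a by omega, pow_add,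
      pow_add, mul_comm (M ^ j), ← mul_assoc]
    gcongr
  · exact fun h => Nat.le_findGreatest hj h

/-- With uniform seeds the tail at `j` is exactly `(M / N) ^ j`: a finite seed set realises a
truncated geometric law with rational ratio. -/
lemma card_le_radiusOfSeed {N M R j : ℕ} (hMN : M ≤ N) (hj : j ≤ R) :
    (Finset.univ.filter fun s : Fin (N ^ R) => j ≤ radiusOfSeed N M R s).card =
      N ^ (R - j) * M ^ j := by
  have hK : N ^ (R - j) * M ^ j ≤ N ^ R := by
    calc N ^ (R - j) * M ^ j ≤ N ^ (R - j) * N ^ j := by gcongr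
      _ = N ^ R := by rw [← pow_add, Nat.sub_add_cancel hj]
  rw [Finset.filter_congr (q := fun s : Fin (N ^ R) => (s : ℕ) < N ^ (R - j) * M ^ j)
    fun s _ => le_radiusOfSeed_iff hMN s.2 hj]
  rw [Fin.card_filter_val_lt, min_eq_right hK]

end Radii

/-! ### The probability that a ball is contained in a cluster -/

section Padding

open Classical in
-- Memorylessness: a monotone `P` is a threshold condition, and passing the threshold by at least
-- one costs only a factor `p`. If the threshold is at least `R`, only the tail `p ^ R` matters.
lemma geometric_shift {S : Type*} [Fintype S] (r : S → ℕ) (R : ℕ) {p : ℝ} (hp0 : 0 ≤ p)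
    (hp1 : p ≤ 1)
    (htail : ∀ j < R, ((Finset.univ.filter fun s => j + 1 ≤ r s).card : ℝ) =
      p * (Finset.univ.filter fun s => j ≤ r s).card)
    (P : ℕ → Prop) (hP : ∀ a b, a ≤ b → P a → P b) :
    p * (Finset.univ.filter fun s => P (r s)).card ≤
      (Finset.univ.filter fun s => ∃ j, r s = j + 1 ∧ P j).card + p ^ R * Fintype.card S := by
  have htop : ∀ j ≤ R, ((Finset.univ.filter fun s => j ≤ r s).card : ℝ) =
      p ^ j * Fintype.card S := by
    intro j
    induction j with
    | zero => simp
    | succ j ih =>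
      intro hj
      rw [htail j (by omega), ih (by omega), pow_succ]
      ring
  by_cases hex : ∃ j, j < R ∧ P j
  · obtain ⟨hj, hPj⟩ := Nat.find_spec hex
    have hmin := fun m => Nat.find_min hex (m := m)
    generalize Nat.find hex = j at *
    have h1 : (Finset.univ.filter fun s => P (r s)) ⊆ Finset.univ.filter fun s => j ≤ r s := by
      intro s hs
      simp only [Finset.mem_filter, Finset.mem_univ, true_and] at hs ⊢
      by_contra hlt
      exact hmin (r s) (by omega) ⟨by omega, hs⟩
    have h2 : (Finset.univ.filter fun s => j + 1 ≤ r s) ⊆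
        Finset.univ.filter fun s => ∃ j, r s = j + 1 ∧ P j := by
      intro s hs
      simp only [Finset.mem_filter, Finset.mem_univ, true_and] at hs ⊢
      exact ⟨r s - 1, by omega, hP j _ (by omega) hPj⟩
    have h1' : ((Finset.univ.filter fun s => P (r s)).card : ℝ) ≤
        (Finset.univ.filter fun s => j ≤ r s).card := by exact_mod_cast Finset.card_le_card h1
    have h2' : ((Finset.univ.filter fun s => j + 1 ≤ r s).card : ℝ) ≤
        (Finset.univ.filter fun s => ∃ j, r s = j + 1 ∧ P j).card := by
      exact_mod_cast Finset.card_le_card h2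
    have h3 : 0 ≤ p ^ R * Fintype.card S := by positivity
    have h4 := mul_le_mul_of_nonneg_left h1' hp0
    rw [← htail j hj] at h4
    linarith
  · have h1 : (Finset.univ.filter fun s => P (r s)) ⊆ Finset.univ.filter fun s => R ≤ r s := by
      intro s hs
      simp only [Finset.mem_filter, Finset.mem_univ, true_and] at hs ⊢
      by_contra hlt
      exact hex ⟨r s, by omega, hs⟩
    have h1' : ((Finset.univ.filter fun s => P (r s)).card : ℝ) ≤
        (Finset.univ.filter fun s => R ≤ r s).card := by exact_mod_cast Finset.card_le_card h1
    rw [htop R le_rfl] at h1'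
    have h2 : p * (Finset.univ.filter fun s => P (r s)).card ≤
        1 * (Finset.univ.filter fun s => P (r s)).card := by gcongr
    have h3 : (0 : ℝ) ≤ (Finset.univ.filter fun s => ∃ j, r s = j + 1 ∧ P j).card := by
      positivity
    linarith

variable {V S : Type*}

/-- The centre `u` wins by a margin `m` at a vertex at distances `δ` from the centres. -/
def WinsBy (g : ℕ) (r : S → ℕ) (δ : V → ℕ∞) (m : ℕ) (f : V → S) (u : V) : Prop :=
  ∀ w, w ≠ u → ((g * r (f w) : ℕ) : ℕ∞) + δ u + (m : ℕ∞) ≤ ((g * r (f u) : ℕ) : ℕ∞) + δ w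

lemma WinsBy.ne_top {g : ℕ} {r : S → ℕ} {δ : V → ℕ∞} {m : ℕ} {f : V → S} {u v : V}
    (h : WinsBy g r δ m f u) (hv : δ v = 0) : δ u ≠ ⊤ := by
  intro htop
  by_cases hxv : v = u
  · subst hxv; simp [hv] at htop
  · have := h v hxv
    rw [htop, hv] at this
    simp only [add_top, top_add, add_zero, top_le_iff] at this
    exact ENat.natCast_ne_top _ this

variable [Fintype V] [Fintype S]

open Classical in
-- Conditioning on the seeds of all vertices other than `u`.
lemma card_filter_eq_sum_update (u : V) (P : S → ({w : V // w ≠ u} → S) → Prop) :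
    (Finset.univ.filter fun ω : V → S => P (ω u) fun w => ω w).card =
      ∑ η : {w : V // w ≠ u} → S, (Finset.univ.filter fun s => P s η).card := by
  simp only [Finset.card_filter]
  rw [← Fintype.sum_prod_type_right (f := fun x : S × ({w : V // w ≠ u} → S) =>
    if P x.1 x.2 then 1 else 0)]
  exact Fintype.sum_equiv (Equiv.funSplitAt u S) _ _ fun ω => rfl

open Classical in
-- With the other radii fixed, winning is monotone in the radius of `u`. If radius `j` already wins,
-- radius `j + 1` wins by `g`, so `geometric_shift` applies.
lemma card_winsBy (g : ℕ) (r : S → ℕ) (R : ℕ) {p : ℝ} (hp0 : 0 ≤ p) (hp1 : p ≤ 1)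
    (htail : ∀ j < R, ((Finset.univ.filter fun s => j + 1 ≤ r s).card : ℝ) =
      p * (Finset.univ.filter fun s => j ≤ r s).card) (δ : V → ℕ∞) (u : V) :
    p * (Finset.univ.filter fun f : V → S => WinsBy g r δ 0 f u).card ≤
      (Finset.univ.filter fun f : V → S => WinsBy g r δ g f u).card +
        p ^ R * Fintype.card (V → S) := by
  obtain ⟨P, hP⟩ : ∃ P : ({w : V // w ≠ u} → S) → ℕ → Prop, ∀ η j, P η j ↔
      ∀ w : {w : V // w ≠ u}, ((g * r (η w) : ℕ) : ℕ∞) + δ u ≤ ((g * j : ℕ) : ℕ∞) + δ w :=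
    ⟨_, fun _ _ => Iff.rfl⟩
  have hA : (Finset.univ.filter fun f : V → S => WinsBy g r δ 0 f u).card =
      ∑ η : {w : V // w ≠ u} → S, (Finset.univ.filter fun s => P η (r s)).card := by
    rw [← card_filter_eq_sum_update u fun s η => P η (r s)]
    congr 1
    refine Finset.filter_congr fun f _ => ?_
    simp [WinsBy, hP]
  have hB : ∑ η : {w : V // w ≠ u} → S,
      (Finset.univ.filter fun s => ∃ j, r s = j + 1 ∧ P η j).card ≤
      (Finset.univ.filter fun f : V → S => WinsBy g r δ g f u).card := by
    rw [← card_filter_eq_sum_update u fun s η => ∃ j, r s = j + 1 ∧ P η j]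
    refine Finset.card_le_card fun f hf => ?_
    simp only [Finset.mem_filter, Finset.mem_univ, true_and] at hf ⊢
    obtain ⟨j, hj, h⟩ := hf
    intro w hw
    rw [hj]
    calc ((g * r (f w) : ℕ) : ℕ∞) + δ u + (g : ℕ∞) ≤ ((g * j : ℕ) : ℕ∞) + δ w + g :=
          add_le_add ((hP _ _).1 h ⟨w, hw⟩) le_rfl
      _ = _ := by push_cast; ring
  have hS : (Fintype.card (V → S) : ℝ) =
      ∑ _η : {w : V // w ≠ u} → S, (Fintype.card S : ℝ) := by
    rw [Finset.sum_const, Finset.card_univ, nsmul_eq_mul,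
      Fintype.card_congr (Equiv.funSplitAt u S), Fintype.card_prod]
    push_cast
    ring
  have hB' : (∑ η : {w : V // w ≠ u} → S,
      ((Finset.univ.filter fun s => ∃ j, r s = j + 1 ∧ P η j).card : ℝ)) ≤
      (Finset.univ.filter fun f : V → S => WinsBy g r δ g f u).card := by exact_mod_cast hB
  refine le_trans ?_ (add_le_add hB' le_rfl)
  rw [hA, hS, Nat.cast_sum, Finset.mul_sum, Finset.mul_sum, ← Finset.sum_add_distrib]
  refine Finset.sum_le_sum fun η _ => geometric_shift r R hp0 hp1 htail (P η) ?_
  intro a b hab h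
  rw [hP] at h ⊢
  exact fun w =>
    (h w).trans (add_le_add (by exact_mod_cast Nat.mul_le_mul_left g hab) le_rfl)

open Classical in
-- Some centre always wins by margin `0`, possibly with ties, while by margin `g ≥ 1` at most one
-- does. Summing `card_winsBy` over centres thus compares the full space with the disjoint events of
-- a clear win.
lemma card_not_winsBy {g : ℕ} (hg : 1 ≤ g) (r : S → ℕ) (R : ℕ) {p : ℝ} (hp0 : 0 ≤ p)
    (hp1 : p ≤ 1)
    (htail : ∀ j < R, ((Finset.univ.filter fun s => j + 1 ≤ r s).card : ℝ) =
      p * (Finset.univ.filter fun s => j ≤ r s).card) (δ : V → ℕ∞) (v : V) (hv : δ v = 0) :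
    ((Finset.univ.filter fun f : V → S => ¬ ∃ u, WinsBy g r δ g f u).card : ℝ) ≤
      (1 - p + Fintype.card V * p ^ R) * Fintype.card (V → S) := by
  have hcover : Fintype.card (V → S) ≤
      ∑ u, (Finset.univ.filter fun f : V → S => WinsBy g r δ 0 f u).card := by
    rw [← Finset.card_univ]
    refine le_trans (Finset.card_le_card ?_) Finset.card_biUnion_le
    intro f _
    simp only [Finset.mem_biUnion, Finset.mem_filter, Finset.mem_univ, true_and]
    have hfin : (Finset.univ.filter fun u : V => δ u ≠ ⊤).Nonempty :=
      ⟨v, by simp [hv]⟩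
    -- The maximum is over reachable centres only, where integer subtraction makes sense;
    -- unreachable ones lose trivially.
    obtain ⟨u, hu, hmax⟩ := Finset.exists_max_image _
      (fun u => ((g * r (f u) : ℕ) : ℤ) - ((δ u).toNat : ℤ)) hfin
    refine ⟨u, fun w _ => ?_⟩
    simp only [Finset.mem_filter, Finset.mem_univ, true_and] at hu
    by_cases hw : δ w = ⊤
    · rw [hw, add_top]; exact le_top
    · have := hmax w (by simp [hw])
      rw [← ENat.natCast_toNat hu, ← ENat.natCast_toNat hw]
      norm_cast
      simp only [add_zero]
      omega
  have hdisj : ∑ u, (Finset.univ.filter fun f : V → S => WinsBy g r δ g f u).card =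
      (Finset.univ.filter fun f : V → S => ∃ u, WinsBy g r δ g f u).card := by
    rw [← Finset.card_biUnion]
    · congr 1
      ext f
      simp
    · intro u _ w _ hne
      refine Finset.disjoint_left.2 fun f hu hw => ?_
      simp only [Finset.mem_filter, Finset.mem_univ, true_and] at hu hw
      have h1 := hu w hne.symm
      have h2 := hw u hne
      rw [← ENat.natCast_toNat (hu.ne_top hv), ← ENat.natCast_toNat (hw.ne_top hv)] at h1 h2
      norm_cast at h1 h2
      omega
  have hsum : p * ∑ u, ((Finset.univ.filter fun f : V → S => WinsBy g r δ 0 f u).card : ℝ) ≤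
      ∑ u, ((Finset.univ.filter fun f : V → S => WinsBy g r δ g f u).card : ℝ) +
        Fintype.card V * (p ^ R * Fintype.card (V → S)) := by
    rw [Finset.mul_sum]
    refine (Finset.sum_le_sum fun u _ =>
      card_winsBy g r R hp0 hp1 htail δ u).trans ?_
    rw [Finset.sum_add_distrib]
    simp
  have hcover' : (Fintype.card (V → S) : ℝ) ≤
      ∑ u, ((Finset.univ.filter fun f : V → S => WinsBy g r δ 0 f u).card : ℝ) := by
    exact_mod_cast hcover
  have hdisj' : ∑ u, ((Finset.univ.filter fun f : V → S => WinsBy g r δ g f u).card : ℝ) =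
      (Finset.univ.filter fun f : V → S => ∃ u, WinsBy g r δ g f u).card := by
    exact_mod_cast hdisj
  have hcompl : ((Finset.univ.filter fun f : V → S => ∃ u, WinsBy g r δ g f u).card : ℝ) +
      (Finset.univ.filter fun f : V → S => ¬ ∃ u, WinsBy g r δ g f u).card =
      Fintype.card (V → S) := by
    rw [← Finset.card_univ]
    exact_mod_cast Finset.card_filter_add_card_filter_not (s := Finset.univ)
      (fun f : V → S => ∃ u, WinsBy g r δ g f u)
  have := mul_le_mul_of_nonneg_left hcover' hp0
  linarith

open Classical in
-- Independence of the copies, by exchanging the roles of vertices and copies.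
lemma card_forall_copies (l : ℕ) (B : (V → S) → Prop) :
    (Finset.univ.filter fun ω : V → Fin l → S => ∀ i, B fun x => ω x i).card =
      (Finset.univ.filter fun f : V → S => B f).card ^ l := by
  rw [← Fintype.card_fin l, ← Fintype.card_piFinset_const, Fintype.card_fin]
  refine Finset.card_equiv (Equiv.piComm fun (_ : V) (_ : Fin l) => S) fun ω => ?_
  simp [Fintype.mem_piFinset, Equiv.piComm]

open Classical in
/-- With many independent copies, every vertex is padded in one of them. -/
lemma card_padded_ge {g : ℕ} (hg : 1 ≤ g) (r : S → ℕ) (R l : ℕ) {p : ℝ} (hp0 : 0 ≤ p)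
    (hp1 : p ≤ 1)
    (htail : ∀ j < R, ((Finset.univ.filter fun s => j + 1 ≤ r s).card : ℝ) =
      p * (Finset.univ.filter fun s => j ≤ r s).card)
    (δ : V → V → ℕ∞) (hδ : ∀ v, δ v v = 0) :
    (1 - Fintype.card V * (1 - p + Fintype.card V * p ^ R) ^ l) *
        Fintype.card (V → Fin l → S) ≤
      ((Finset.univ.filter fun ω : V → Fin l → S =>
        ∀ v, ∃ i, ∃ u, WinsBy g r (δ v) g (fun x => ω x i) u).card : ℝ) := by
  have hbad : ∀ v, ((Finset.univ.filter fun ω : V → Fin l → S =>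
      ∀ i, ¬ ∃ u, WinsBy g r (δ v) g (fun x => ω x i) u).card : ℝ) ≤
      (1 - p + Fintype.card V * p ^ R) ^ l * Fintype.card (V → Fin l → S) := by
    intro v
    have hcopies := card_forall_copies l fun f => ¬ ∃ u, WinsBy g r (δ v) g f u
    refine le_trans (le_of_eq (Eq.trans ?_ (congrArg (Nat.cast : ℕ → ℝ) hcopies))) ?_
    · congr!
    rw [Nat.cast_pow]
    have hcard : Fintype.card (V → Fin l → S) = Fintype.card (V → S) ^ l := by
      rw [Fintype.card_congr (Equiv.piComm fun (_ : V) (_ : Fin l) => S)]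
      simp
    rw [hcard]
    push_cast
    rw [← mul_pow]
    refine pow_le_pow_left₀ (by positivity) ?_ l
    refine le_of_eq_of_le ?_ (card_not_winsBy hg r R hp0 hp1 htail (δ v) v (hδ v))
    congr!
  have hunion : Fintype.card (V → Fin l → S) ≤
      (Finset.univ.filter fun ω : V → Fin l → S =>
        ∀ v, ∃ i, ∃ u, WinsBy g r (δ v) g (fun x => ω x i) u).card +
      ∑ v, (Finset.univ.filter fun ω : V → Fin l → S =>
        ∀ i, ¬ ∃ u, WinsBy g r (δ v) g (fun x => ω x i) u).card := by
    refine le_trans ?_ (add_le_add le_rfl Finset.card_biUnion_le)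
    refine le_trans ?_ (Finset.card_union_le _ _)
    rw [← Finset.card_univ]
    refine Finset.card_le_card fun ω _ => ?_
    simp only [Finset.mem_union, Finset.mem_biUnion, Finset.mem_filter, Finset.mem_univ, true_and]
    by_cases h : ∀ v, ∃ i, ∃ u, WinsBy g r (δ v) g (fun x => ω x i) u
    · exact Or.inl h
    · right
      push Not at h ⊢
      exact h
  have hunion' : (Fintype.card (V → Fin l → S) : ℝ) ≤
      (Finset.univ.filter fun ω : V → Fin l → S =>
        ∀ v, ∃ i, ∃ u, WinsBy g r (δ v) g (fun x => ω x i) u).card +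
      ∑ v, ((Finset.univ.filter fun ω : V → Fin l → S =>
        ∀ i, ¬ ∃ u, WinsBy g r (δ v) g (fun x => ω x i) u).card : ℝ) := by
    exact_mod_cast hunion
  have hsum := Finset.sum_le_sum fun v (_ : v ∈ Finset.univ) => hbad v
  rw [Finset.sum_const, Finset.card_univ, nsmul_eq_mul] at hsum
  linarith

end Padding

/-! ### The choice of the parameters -/

section Parameters

/-- The inverse of the loss of a single copy in the case of small `n`. -/
def lossBase (k : ℕ) : ℕ := 2 * 3 ^ k

/-- The bound for the radii before scaling. -/
def radiusBound (k : ℕ) : ℕ := lossBase k ^ 3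

/-- The number of independent copies. -/
noncomputable def numCopies (c n k : ℕ) : ℕ :=
  ⌈(32 * (c + 1) : ℝ) * (n : ℝ) ^ (1 / (k : ℝ))⌉₊

/-- The probability that some vertex is not padded in any copy is small for a suitable rational
parameter of the geometric distribution. -/
def SuitableRatio (c n k M N : ℕ) : Prop :=
  0 < N ∧ M ≤ N ∧
    (n : ℝ) * (1 - (M / N : ℝ) + n * (M / N : ℝ) ^ radiusBound k) ^ numCopies c n k ≤
      1 / (n : ℝ) ^ c

lemma six_le_lossBase {k : ℕ} (hk : 1 ≤ k) : 6 ≤ lossBase k := by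
  unfold lossBase
  have : 3 ^ 1 ≤ 3 ^ k := Nat.pow_le_pow_right (by norm_num) hk
  omega

lemma mul_pow_le_of_exp {c n : ℕ} (hn : 2 ≤ n) {b E : ℝ} {l : ℕ} (hb0 : 0 ≤ b)
    (hb : b ≤ Real.exp (-E)) (hE : (c + 1) * Real.log n ≤ l * E) :
    (n : ℝ) * b ^ l ≤ 1 / (n : ℝ) ^ c := by
  have hn0 : (0 : ℝ) < n := by positivity
  have h1 : b ^ l ≤ Real.exp (-((c + 1) * Real.log n)) := by
    calc b ^ l ≤ Real.exp (-E) ^ l := pow_le_pow_left₀ hb0 hb l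
      _ = Real.exp (-(l * E)) := by rw [← Real.exp_nat_mul]; ring_nf
      _ ≤ _ := Real.exp_le_exp.2 (by linarith)
  have h2 : Real.exp (-((c + 1) * Real.log n)) = 1 / (n : ℝ) ^ (c + 1) := by
    rw [Real.exp_neg, one_div]
    congr 1
    have : ((c : ℝ) + 1) * Real.log n = ((c + 1 : ℕ) : ℝ) * Real.log n := by push_cast; ring
    rw [this, Real.exp_nat_mul, Real.exp_log hn0]
  calc (n : ℝ) * b ^ l ≤ n * (1 / (n : ℝ) ^ (c + 1)) := by rw [← h2]; gcongr
    _ = 1 / (n : ℝ) ^ c := by rw [pow_succ]; field_simp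

lemma rpow_eq_exp {n : ℕ} (hn : 2 ≤ n) (k : ℕ) :
    (n : ℝ) ^ (1 / (k : ℝ)) = Real.exp (Real.log n / k) := by
  rw [Real.rpow_def_of_pos (by positivity)]
  congr 1
  ring

/-- With `Q = lossBase k` and `p = 1 - 1/Q`, a copy fails with probability at most `2/Q = 3 ^ (-k) ≤
exp (-k)`, so `(c + 1) * log n / k` copies suffice. The radius bound `Q ^ 3` gives `p ^ R ≤ exp (-Q
^ 2)`, which beats `n * Q` exactly under `h`. -/
lemma suitableRatio_of_small (c : ℕ) {n k : ℕ} (hn : 2 ≤ n) (hk : 1 ≤ k)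
    (h : Real.log n + Real.log (lossBase k) ≤ (lossBase k : ℝ) ^ 2) :
    SuitableRatio c n k (lossBase k - 1) (lossBase k) := by
  have hQ := six_le_lossBase hk
  refine ⟨by omega, by omega, ?_⟩
  have hQr : (6 : ℝ) ≤ lossBase k := by exact_mod_cast hQ
  have hp : (((lossBase k - 1 : ℕ) : ℝ) / lossBase k) = 1 - 1 / (lossBase k : ℝ) := by
    rw [Nat.cast_sub (by omega)]
    push_cast
    field_simp
  rw [hp]
  have hQdef : (lossBase k : ℝ) = 2 * 3 ^ k := by simp [lossBase]
  have hk0 : (0 : ℝ) < k := by exact_mod_cast hk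
  have hn0 : (0 : ℝ) < n := by positivity
  have hp0 : 0 ≤ 1 - 1 / (lossBase k : ℝ) := by
    rw [sub_nonneg, div_le_one (by linarith)]; linarith
  have hpow : (n : ℝ) * (1 - 1 / (lossBase k : ℝ)) ^ radiusBound k ≤ 1 / lossBase k := by
    have h1 : (1 - 1 / (lossBase k : ℝ)) ^ radiusBound k ≤ Real.exp (-(lossBase k : ℝ) ^ 2) := by
      calc (1 - 1 / (lossBase k : ℝ)) ^ radiusBound k
          ≤ Real.exp (-(1 / (lossBase k : ℝ))) ^ radiusBound k :=
            pow_le_pow_left₀ hp0 (Real.one_sub_le_exp_neg _) _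
        _ = Real.exp (-(lossBase k : ℝ) ^ 2) := by
            rw [← Real.exp_nat_mul]
            congr 1
            simp only [radiusBound]
            push_cast
            field_simp
    calc (n : ℝ) * (1 - 1 / (lossBase k : ℝ)) ^ radiusBound k
        ≤ Real.exp (Real.log n) * Real.exp (-(lossBase k : ℝ) ^ 2) := by
          rw [Real.exp_log hn0]; gcongr
      _ = Real.exp (Real.log n - (lossBase k : ℝ) ^ 2) := by rw [← Real.exp_add]; ring_nf
      _ ≤ Real.exp (-Real.log (lossBase k)) := Real.exp_le_exp.2 (by linarith)
      _ = 1 / lossBase k := by rw [Real.exp_neg, Real.exp_log (by linarith), one_div]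
  refine mul_pow_le_of_exp hn (E := k) ?_ ?_ ?_
  · have : 0 ≤ (n : ℝ) * (1 - 1 / (lossBase k : ℝ)) ^ radiusBound k := by positivity
    have h2 : 0 ≤ 1 / (lossBase k : ℝ) := by positivity
    linarith
  · calc 1 - (1 - 1 / (lossBase k : ℝ)) + n * (1 - 1 / (lossBase k : ℝ)) ^ radiusBound k
        ≤ 1 / (lossBase k : ℝ) + 1 / lossBase k := by linarith
      _ = ((3 : ℝ) ^ k)⁻¹ := by rw [hQdef]; field_simp; norm_num
      _ ≤ (Real.exp 1 ^ k)⁻¹ := by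
          gcongr
          exact Real.exp_one_lt_d9.le.trans (by norm_num)
      _ = Real.exp (-k) := by rw [Real.exp_neg, ← Real.exp_nat_mul, mul_one]
  · have hl : (32 * (c + 1) : ℝ) * Real.exp (Real.log n / k) ≤ numCopies c n k := by
      rw [← rpow_eq_exp hn]; exact Nat.le_ceil _
    have hx : Real.log n / k ≤ Real.exp (Real.log n / k) :=
      (by linarith [Real.add_one_le_exp (Real.log n / k)])
    have hL : 0 ≤ Real.log n := Real.log_natCast_nonneg n
    calc ((c : ℝ) + 1) * Real.log n = (c + 1) * (Real.log n / k) * k := by field_simp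
      _ ≤ (32 * (c + 1)) * Real.exp (Real.log n / k) * k := by
          gcongr
          linarith [(by positivity : (0 : ℝ) ≤ c)]
      _ ≤ numCopies c n k * k := by gcongr

/-- For very large `n`, radii of size `exp(O(k))` no longer permit `p` near one. Instead `p` is
about `n ^ (-1/(2k))`: a copy succeeds with probability at least `p / 2`, and `n ^ (1/k)` copies
leave a surplus `n ^ (1/(2k))` that dominates `log n`. -/
lemma suitableRatio_of_large (c : ℕ) {n k : ℕ} (hn : 2 ≤ n) (hk : 1 ≤ k)
    (h : (lossBase k : ℝ) ^ 2 < Real.log n + Real.log (lossBase k)) :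
    SuitableRatio c n k 1 ⌈Real.exp (Real.log n / k / 2)⌉₊ := by
  have hQ : (6 : ℝ) ≤ lossBase k := by exact_mod_cast six_le_lossBase hk
  have hk0 : (0 : ℝ) < k := by exact_mod_cast hk
  have hn0 : (0 : ℝ) < n := by positivity
  have hL0 : 0 ≤ Real.log n := Real.log_natCast_nonneg n
  set L := Real.log n with hLdef
  set x := L / k with hxdef
  have hx0 : 0 ≤ x := by positivity
  have hLx : L = k * x := by rw [hxdef]; field_simp
  have hkQ : (k : ℝ) ≤ lossBase k / 2 := by
    have : k < 3 ^ k := Nat.lt_pow_self (by norm_num)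
    have : (k : ℝ) < (3 : ℝ) ^ k := by exact_mod_cast this
    simp only [lossBase]; push_cast; linarith
  have hL : (lossBase k : ℝ) ^ 2 / 2 ≤ L := by
    have := Real.log_le_sub_one_of_pos (by linarith : (0 : ℝ) < lossBase k)
    nlinarith
  have hkx : (k : ℝ) ≤ x := by
    rw [hxdef, le_div_iff₀ hk0]
    nlinarith
  set P := ⌈Real.exp (x / 2)⌉₊ with hPdef
  have hP1 : Real.exp (x / 2) ≤ P := Nat.le_ceil _
  have hexp1 : 1 ≤ Real.exp (x / 2) := Real.one_le_exp (by positivity)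
  have hP2 : (P : ℝ) ≤ 2 * Real.exp (x / 2) := by
    have := (Nat.ceil_lt_add_one (Real.exp_pos (x / 2)).le).le
    linarith
  have hP0 : (0 : ℝ) < P := by linarith
  have hPpos : 0 < P := by exact_mod_cast hP0
  refine ⟨hPpos, hPpos, ?_⟩
  rw [Nat.cast_one]
  have hR : 4 * k + 1 ≤ radiusBound k := by
    have h1 : k < 3 ^ k := Nat.lt_pow_self (by norm_num)
    have h2 : 2 * 3 ^ k ≤ (2 * 3 ^ k) ^ 3 := Nat.le_self_pow (by norm_num) _
    have h3 : (2 * 3 ^ k) ^ 3 = 4 * 3 ^ k * (2 * 3 ^ k * 3 ^ k) := by ring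
    have h4 : 4 * 3 ^ k * 2 ≤ 4 * 3 ^ k * (2 * 3 ^ k * 3 ^ k) := by
      apply Nat.mul_le_mul_left; nlinarith
    simp only [radiusBound, lossBase]
    omega
  -- Of the exponent, `4 * k` factors give `1 / n ^ 2`, one factor is kept as `1 / P`, and the rest
  -- are at most one; finally `n * (1 / n ^ 2) ≤ 1 / 2`.
  have hpow : (n : ℝ) * (1 / (P : ℝ)) ^ radiusBound k ≤ 1 / P / 2 := by
    obtain ⟨m, hm⟩ := Nat.exists_eq_add_of_le' hR
    have hle1 : (1 / (P : ℝ)) ≤ Real.exp (-(x / 2)) := by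
      rw [Real.exp_neg, one_div]; gcongr
    have h1 : (1 / (P : ℝ)) ^ (4 * k) ≤ 1 / (n : ℝ) ^ 2 := by
      calc (1 / (P : ℝ)) ^ (4 * k) ≤ Real.exp (-(x / 2)) ^ (4 * k) :=
            pow_le_pow_left₀ (by positivity) hle1 _
        _ = Real.exp (-(2 * L)) := by
            rw [← Real.exp_nat_mul, hLx]; push_cast; ring_nf
        _ = 1 / (n : ℝ) ^ 2 := by
            rw [Real.exp_neg, one_div, show 2 * L = ((2 : ℕ) : ℝ) * L by norm_num,
              Real.exp_nat_mul, hLdef, Real.exp_log hn0]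
    have h2 : (1 / (P : ℝ)) ^ m ≤ 1 := by
      refine pow_le_one₀ (by positivity) ?_
      rw [div_le_one hP0]; linarith
    rw [hm, show m + (4 * k + 1) = m + 4 * k + 1 by ring, pow_succ, pow_add]
    calc (n : ℝ) * ((1 / (P : ℝ)) ^ m * (1 / (P : ℝ)) ^ (4 * k) * (1 / P))
        ≤ n * (1 * (1 / (n : ℝ) ^ 2) * (1 / P)) := by gcongr
      _ = (1 / n) * (1 / P) := by field_simp
      _ ≤ (1 / 2) * (1 / P) := by gcongr; exact_mod_cast hn
      _ = 1 / P / 2 := by ring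
  refine mul_pow_le_of_exp hn (E := 1 / P / 2) ?_ ?_ ?_
  · have : 1 / (P : ℝ) ≤ 1 := by rw [div_le_one hP0]; linarith
    have h2 : 0 ≤ (n : ℝ) * (1 / (P : ℝ)) ^ radiusBound k := by positivity
    linarith
  · calc 1 - 1 / (P : ℝ) + n * (1 / (P : ℝ)) ^ radiusBound k ≤ 1 - 1 / P / 2 := by linarith
      _ ≤ _ := Real.one_sub_le_exp_neg _
  · have hl : (32 * (c + 1) : ℝ) * Real.exp x ≤ numCopies c n k := by
      rw [hxdef, hLdef, ← rpow_eq_exp hn]; exact Nat.le_ceil _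
    have hexp : Real.exp x = Real.exp (x / 2) * Real.exp (x / 2) := by
      rw [← Real.exp_add]; ring_nf
    have hq : x ^ 2 / 8 ≤ Real.exp (x / 2) := by
      have := Real.quadratic_le_exp_of_nonneg (x := x / 2) (by positivity)
      nlinarith
    have hc : (0 : ℝ) ≤ c := by positivity
    -- Here `L = k * x ≤ x ^ 2` by `hkx`. The constant `32` of `numCopies` is `8` from `hq` times
    -- `4`, made of the `2` in `hP2` and the halved success probability.
    calc ((c : ℝ) + 1) * L ≤ (c + 1) * x ^ 2 := by
          rw [hLx, sq]; gcongr
      _ ≤ (c + 1) * (8 * Real.exp (x / 2)) := by gcongr; linarith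
      _ = (32 * (c + 1)) * Real.exp x / (2 * (2 * Real.exp (x / 2))) := by
          rw [hexp]; field_simp; norm_num
      _ ≤ numCopies c n k / (2 * P) := by gcongr
      _ = numCopies c n k * (1 / P / 2) := by field_simp

lemma exists_suitableRatio (c : ℕ) {n k : ℕ} (hn : 2 ≤ n) (hk : 1 ≤ k) :
    ∃ M N, SuitableRatio c n k M N := by
  rcases le_or_gt (Real.log n + Real.log (lossBase k)) ((lossBase k : ℝ) ^ 2) with h | h
  · exact ⟨_, _, suitableRatio_of_small c hn hk h⟩
  · exact ⟨_, _, suitableRatio_of_large c hn hk h⟩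

lemma numCopies_le (c : ℕ) {n : ℕ} (hn : 1 ≤ n) (k : ℕ) :
    (numCopies c n k : ℝ) ≤ (32 * (c + 1) + 1) * (n : ℝ) ^ (1 / (k : ℝ)) := by
  have h1 : (1 : ℝ) ≤ (n : ℝ) ^ (1 / (k : ℝ)) :=
    Real.one_le_rpow (by exact_mod_cast hn) (by positivity)
  have h2 : (numCopies c n k : ℝ) < 32 * (c + 1) * (n : ℝ) ^ (1 / (k : ℝ)) + 1 :=
    Nat.ceil_lt_add_one (by positivity)
  linarith

/-- Since `radiusBound k ^ 2 = 64 * 729 ^ k`, the left side is `2880 * 729 ^ k`; the exponent `15`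
comes from `2880 * 729 ≤ 2.7 ^ 15`. -/
lemma radiusBound_sq_le (k : ℕ) (hk : 1 ≤ k) :
    ((45 * radiusBound k ^ 2 : ℕ) : ℝ) ≤ Real.exp (15 * k) := by
  have he : (2.7 : ℝ) ≤ Real.exp 1 := Real.exp_one_gt_d9.le.trans' (by norm_num)
  have h15 : (2880 * 729 : ℝ) ≤ Real.exp 1 ^ 15 :=
    le_trans (by norm_num) (pow_le_pow_left₀ (by norm_num) he 15)
  calc ((45 * radiusBound k ^ 2 : ℕ) : ℝ) = 2880 * 729 ^ k := by
        simp only [radiusBound, lossBase]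
        push_cast
        have h : (729 : ℝ) ^ k = (3 ^ k) ^ 6 := by
          rw [← pow_mul, mul_comm, pow_mul]; norm_num
        rw [h]
        ring
    _ ≤ 2880 ^ k * 729 ^ k := by
        gcongr
        exact le_self_pow₀ (by norm_num) (by omega)
    _ = (2880 * 729) ^ k := by rw [mul_pow]
    _ ≤ (Real.exp 1 ^ 15) ^ k := by gcongr
    _ = Real.exp (15 * k) := by
        rw [← pow_mul, ← Real.exp_nat_mul]; push_cast; ring_nf

end Parameters

/-! ### Relabelling the vertices -/

section Relabelling

variable {V W : Type*} (f : V ↪ W)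

lemma exists_of_edist_map_le (G : SimpleGraph V) (u : V) {m : ℕ} {y : W}
    (h : (G.map f).edist (f u) y ≤ (m : ℕ∞)) : ∃ v, f v = y ∧ G.edist u v ≤ (m : ℕ∞) := by
  induction m generalizing y with
  | zero => exact ⟨u, by simpa using h, by simp⟩
  | succ m ih =>
    rcases (edist_le_succ_iff ..).1 h with h | ⟨z, h, hz⟩
    · obtain ⟨v, hv, hd⟩ := ih h
      exact ⟨v, hv, hd.trans (by exact_mod_cast Nat.le_succ m)⟩
    · obtain ⟨v, hv, hd⟩ := ih h
      obtain ⟨a, b, hab, ha, hb⟩ := (G.map_adj f _ _).1 hz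
      obtain rfl := f.injective (ha.trans hv.symm)
      exact ⟨b, hb, (edist_le_succ_iff ..).2 (Or.inr ⟨a, hd, hab⟩)⟩

lemma edist_map (G : SimpleGraph V) (u v : V) : (G.map f).edist (f u) (f v) = G.edist u v := by
  refine le_antisymm ?_ ?_
  · by_cases h : G.edist u v = ⊤
    · rw [h]; exact le_top
    · obtain ⟨p, hp⟩ := exists_walk_of_edist_ne_top h
      rw [← hp]
      refine (edist_le (p.map (Embedding.map f G).toHom)).trans ?_
      exact_mod_cast (Walk.length_map _ _).le
  · by_cases h : (G.map f).edist (f u) (f v) = ⊤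
    · rw [h]; exact le_top
    · obtain ⟨m, hm⟩ := ENat.ne_top_iff_exists.1 h
      obtain ⟨w, hw, hd⟩ := exists_of_edist_map_le f G u hm.symm.le
      obtain rfl := f.injective hw
      rwa [← hm]

lemma edist_map_eq_top (G : SimpleGraph V) (v : V) {w : W} (hw : ∀ x, f x ≠ w) :
    (G.map f).edist w (f v) = ⊤ := by
  by_contra h
  obtain ⟨m, hm⟩ := ENat.ne_top_iff_exists.1 h
  rw [edist_comm] at hm
  obtain ⟨x, hx, -⟩ := exists_of_edist_map_le f G v hm.symm.le
  exact hw x hx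

lemma ncard_edgeSet_map (G : SimpleGraph V) :
    (G.map f).edgeSet.ncard = G.edgeSet.ncard := by
  rw [edgeSet_map]
  exact Set.ncard_image_of_injective _ f.sym2Map.injective

lemma map_comap_of_le {G : SimpleGraph V} {H : SimpleGraph W} (h : H ≤ G.map f) :
    (H.comap f).map f = H := by
  ext x y
  rw [map_adj]
  constructor
  · rintro ⟨a, b, hab, rfl, rfl⟩
    exact hab
  · intro hxy
    obtain ⟨a, b, -, rfl, rfl⟩ := (map_adj f G _ _).1 (h hxy)
    exact ⟨a, b, hxy, rfl, rfl⟩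

end Relabelling

/-- The union of the local spanners, computed with relabelled vertices, is an approximate minimum
spanner if every vertex is padded in some copy. -/
lemma isApproxMinSpanner_comap {V W : Type} [Finite V] (f : V ↪ W) (G : SimpleGraph V)
    {q : ClusterParams} {ρ : W → ℕ → ℕ} {R : ℕ} (hρ : ∀ x i, ρ x i ≤ R) (hs : 1 ≤ q.pad)
    (ht : 1 ≤ q.stretch) (hR : q.stretch ≤ q.pad ∨ 2 * (q.gap * R) ≤ q.stretch) {U : Finset W}
    (hpad : ∀ v, ∃ i < q.copies, ∃ u ∈ U, ∀ z, (G.map f).edist (f v) z ≤ (q.pad : ℕ∞) →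
      z ∈ copyCluster q (G.map f) ρ i u)
    {α : ℝ} (hα : 2 * (q.copies : ℝ) ≤ α) :
    IsApproxMinSpanner q.stretch α G ((clusterSpanner q (G.map f) ρ U).comap f) := by
  have hle : clusterSpanner q (G.map f) ρ U ≤ G.map f := clusterSpanner_le U
  have hmap := map_comap_of_le f hle
  have hfin : (G.map f).edgeSet.Finite := by
    rw [edgeSet_map]; exact (Set.toFinite _).image _
  refine ⟨⟨?_, fun u v => ?_⟩, fun H' hH' => ?_⟩
  · rintro x y hxy
    exact (map_adj_apply (f := f)).1 (hle hxy)
  · rw [← edist_map f, ← edist_map f G, hmap]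
    refine edist_clusterSpanner_le hs ht (fun x y hxy => ?_) _ _
    obtain ⟨a, b, -, rfl, rfl⟩ := (map_adj f G _ _).1 hxy
    exact hpad a
  · have hst : ∀ x y, (H'.map f).edist x y ≤ (q.stretch : ℕ∞) * (G.map f).edist x y := by
      refine edist_le_mul_of_adj (fun x y hxy => ?_) ht
      obtain ⟨a, b, hab, rfl, rfl⟩ := (map_adj f G _ _).1 hxy
      rw [edist_map]
      simpa [edist_eq_one_iff_adj.2 hab] using hH'.2 a b
    have h := ncard_clusterSpanner_le_mul hfin hρ hs hR U (map_monotone f hH'.1) hst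
    rw [ncard_edgeSet_map, ← hmap, ncard_edgeSet_map] at h
    calc (((clusterSpanner q (G.map f) ρ U).comap f).edgeSet.ncard : ℝ)
        ≤ (q.copies * (2 * H'.edgeSet.ncard) : ℕ) := by exact_mod_cast h
      _ = 2 * (q.copies : ℝ) * H'.edgeSet.ncard := by push_cast; ring
      _ ≤ _ := by gcongr

/-! ### The distributed algorithm -/

/-- What a vertex knows: the parameters, its identifier, and the edges and labels of the part of
the network that it has heard of. -/
structure NodeState where
  params : SpannerParams
  id : ℕ
  edges : Set (ℕ × ℕ)
  labels : Set (ℕ × (ℕ → ℕ))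

/-- The update of a vertex that collects everything its neighbours know. -/
def NodeState.update (st : NodeState) (M : Set (ℕ × NodeState)) : NodeState where
  params := st.params
  id := st.id
  edges := st.edges ∪ {e | ∃ m ∈ M, e = (st.id, m.1) ∨ e ∈ m.2.edges}
  labels := st.labels ∪ {e | ∃ m ∈ M, e ∈ m.2.labels}

/-- The graph formed by the known edges. -/
def NodeState.graph (st : NodeState) : SimpleGraph ℕ :=
  SimpleGraph.fromRel fun a b => (a, b) ∈ st.edges

open Classical in
/-- The known labels, extended by zero. -/
noncomputable def NodeState.label (st : NodeState) (a : ℕ) : ℕ → ℕ :=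
  if h : ∃ l, (a, l) ∈ st.labels then h.choose else 0

/-- The padding: large stretch does not need large clusters. -/
def padding (p : SpannerParams) : ℕ := if 6 * radiusBound p.k ≤ p.t then 1 else p.t

/-- The parameters of the clustering. -/
noncomputable def clusterParams (c : ℕ) (p : SpannerParams) : ClusterParams :=
  ⟨numCopies c p.n p.k, p.t, padding p⟩

open Classical in
/-- Numerator and denominator of the parameter of the geometric distribution. -/
noncomputable def geomRatio (c : ℕ) (p : SpannerParams) : ℕ × ℕ :=
  if h : ∃ x : ℕ × ℕ, SuitableRatio c p.n p.k x.1 x.2 then h.choose else (0, 1)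

lemma geomRatio_pos (c : ℕ) (p : SpannerParams) : 0 < (geomRatio c p).2 := by
  unfold geomRatio
  split_ifs with h
  · exact h.choose_spec.1
  · exact one_pos

lemma suitableRatio_geomRatio (c : ℕ) {p : SpannerParams} (hn : 2 ≤ p.n) (hk : 1 ≤ p.k) :
    SuitableRatio c p.n p.k (geomRatio c p).1 (geomRatio c p).2 := by
  have h : ∃ x : ℕ × ℕ, SuitableRatio c p.n p.k x.1 x.2 := by
    obtain ⟨M, N, h⟩ := exists_suitableRatio c hn hk
    exact ⟨(M, N), h⟩
  unfold geomRatio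
  rw [dif_pos h]
  exact h.choose_spec

/-- The number of seeds of a single copy. -/
noncomputable def copySeeds (c : ℕ) (p : SpannerParams) : ℕ :=
  (geomRatio c p).2 ^ radiusBound p.k

/-- The radius obtained from the seed of a single copy. -/
noncomputable def copyRadius (c : ℕ) (p : SpannerParams) (s : Fin (copySeeds c p)) : ℕ :=
  radiusOfSeed (geomRatio c p).2 (geomRatio c p).1 (radiusBound p.k) s

/-- The radii of all copies, obtained from the seed of a vertex. -/
noncomputable def seedRadii (c : ℕ) (p : SpannerParams)
    (s : Fin (copySeeds c p ^ numCopies c p.n p.k)) (i : ℕ) : ℕ :=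
  if h : i < numCopies c p.n p.k then copyRadius c p (finFunctionFinEquiv.symm s ⟨i, h⟩) else 0

lemma seedRadii_le (c : ℕ) (p : SpannerParams)
    (s : Fin (copySeeds c p ^ numCopies c p.n p.k)) (i : ℕ) :
    seedRadii c p s i ≤ radiusBound p.k := by
  unfold seedRadii
  split_ifs
  · exact radiusOfSeed_le _ _ _ _
  · exact Nat.zero_le _

/-- The distance up to which a vertex has to know the network. -/
noncomputable def horizon (c : ℕ) (p : SpannerParams) : ℕ :=
  (clusterParams c p).gap * radiusBound p.k + (clusterParams c p).pad +
    (clusterParams c p).gap * radiusBound p.k + (clusterParams c p).gap * radiusBound p.k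

/-- Every vertex collects the network up to the horizon and outputs its edges in the union of the
local spanners of what it knows. -/
noncomputable def spannerAlgorithm (c : ℕ) : DistributedAlgorithm SpannerParams where
  State := NodeState
  Msg := NodeState
  numSeeds p := copySeeds c p ^ numCopies c p.n p.k
  numSeeds_pos p := Nat.pow_pos (Nat.pow_pos (geomRatio_pos c p))
  rounds p := horizon c p + 1
  init p i s := ⟨p, i, ∅, {(i, seedRadii c p s)}⟩
  send st := st
  receive := NodeState.update
  output st := {i | (clusterSpanner (clusterParams c st.params) st.graph st.label
    (Finset.range (st.params.n + 1))).Adj st.id i}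

/-! ### Flooding and correctness of the local outputs -/

section Execution

variable {c : ℕ} {p : SpannerParams} {V : Type} (G : SimpleGraph V) (f : V ↪ ℕ)
  (ω : V → Fin ((spannerAlgorithm c).numSeeds p))

/-- The knowledge of a vertex after `r` rounds. -/
noncomputable def knowledge (r : ℕ) (v : V) : NodeState :=
  (spannerAlgorithm c).stateAfter p G f ω r v

lemma knowledge_succ (r : ℕ) (v : V) :
    knowledge G f ω (r + 1) v = (knowledge G f ω r v).update
      {m | ∃ u, G.Adj v u ∧ m = (f u, knowledge G f ω r u)} := rfl

lemma knowledge_params (r : ℕ) (v : V) : (knowledge G f ω r v).params = p := by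
  induction r with
  | zero => rfl
  | succ r ih => rw [knowledge_succ]; exact ih

lemma knowledge_id (r : ℕ) (v : V) : (knowledge G f ω r v).id = f v := by
  induction r with
  | zero => rfl
  | succ r ih => rw [knowledge_succ]; exact ih

lemma knowledge_edges_sound (r : ℕ) (v : V) {e : ℕ × ℕ} (h : e ∈ (knowledge G f ω r v).edges) :
    (G.map f).Adj e.1 e.2 := by
  induction r generalizing v with
  | zero => exact absurd h (Set.notMem_empty e)
  | succ r ih =>
    rw [knowledge_succ] at h
    rcases h with h | ⟨_, ⟨u, hu, rfl⟩, h | h⟩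
    · exact ih v h
    · rw [h, knowledge_id]
      exact map_adj_apply.2 hu
    · exact ih u h

lemma knowledge_labels_sound (r : ℕ) (v : V) {e : ℕ × (ℕ → ℕ)}
    (h : e ∈ (knowledge G f ω r v).labels) : ∃ x, e = (f x, seedRadii c p (ω x)) := by
  induction r generalizing v with
  | zero => exact ⟨v, h⟩
  | succ r ih =>
    rw [knowledge_succ] at h
    rcases h with h | ⟨_, ⟨u, hu, rfl⟩, h⟩
    · exact ih v h
    · exact ih u h

/-- The extra round is needed because a vertex learns its neighbours' identifiers only from their
first messages. -/
lemma knowledge_edges_complete (r : ℕ) {v x y : V} (h : G.edist x v ≤ (r : ℕ∞))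
    (hxy : G.Adj x y) : (f x, f y) ∈ (knowledge G f ω (r + 1) v).edges := by
  induction r generalizing v with
  | zero =>
    obtain rfl : x = v := by simpa using h
    rw [knowledge_succ]
    exact Or.inr ⟨_, ⟨y, hxy, rfl⟩, Or.inl (by rw [knowledge_id])⟩
  | succ r ih =>
    rw [knowledge_succ]
    rcases (edist_le_succ_iff ..).1 h with h | ⟨z, h, hz⟩
    · exact Or.inl (ih h)
    · exact Or.inr ⟨_, ⟨z, hz.symm, rfl⟩, Or.inr (ih h)⟩

lemma knowledge_labels_complete (r : ℕ) {v x : V} (h : G.edist x v ≤ (r : ℕ∞)) :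
    (f x, seedRadii c p (ω x)) ∈ (knowledge G f ω r v).labels := by
  induction r generalizing v with
  | zero =>
    obtain rfl : x = v := by simpa using h
    exact rfl
  | succ r ih =>
    rw [knowledge_succ]
    rcases (edist_le_succ_iff ..).1 h with h | ⟨z, h, hz⟩
    · exact Or.inl (ih h)
    · exact Or.inr ⟨_, ⟨z, hz.symm, rfl⟩, ih h⟩

/-- The labels of all vertices, extended by zero. -/
noncomputable def trueLabel : ℕ → ℕ → ℕ := Function.extend f (fun x => seedRadii c p (ω x)) 0

lemma trueLabel_apply (x : V) : trueLabel f ω (f x) = seedRadii c p (ω x) :=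
  f.injective.extend_apply _ _ _

lemma trueLabel_le (a i : ℕ) : trueLabel f ω a i ≤ radiusBound p.k := by
  by_cases h : ∃ x, f x = a
  · obtain ⟨x, rfl⟩ := h
    rw [trueLabel_apply]
    exact seedRadii_le c p _ i
  · rw [trueLabel, Function.extend_apply' _ _ _ h]
    exact Nat.zero_le _

lemma knowledge_label_le (r : ℕ) (v : V) (a i : ℕ) :
    (knowledge G f ω r v).label a i ≤ radiusBound p.k := by
  unfold NodeState.label
  split_ifs with h
  · obtain ⟨x, hx⟩ := knowledge_labels_sound G f ω r v h.choose_spec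
    have hl : h.choose = seedRadii c p (ω x) := (Prod.ext_iff.1 hx).2
    rw [hl]
    exact seedRadii_le c p _ i
  · exact Nat.zero_le _

lemma locallyEqual_knowledge (r : ℕ) (v : V) :
    LocallyEqual (G.map f) (trueLabel f ω) (knowledge G f ω (r + 1) v).graph
      (knowledge G f ω (r + 1) v).label (f v) r := by
  intro a ha
  obtain ⟨x, rfl, hx⟩ := exists_of_edist_map_le f G v ha
  rw [edist_comm] at hx
  constructor
  · have hmem := knowledge_labels_complete G f ω (r + 1)
      (hx.trans (by exact_mod_cast Nat.le_succ r))
    have hex : ∃ l, (f x, l) ∈ (knowledge G f ω (r + 1) v).labels := ⟨_, hmem⟩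
    obtain ⟨x', hx'⟩ := knowledge_labels_sound G f ω (r + 1) v hex.choose_spec
    obtain ⟨h1, h2⟩ := Prod.ext_iff.1 hx'
    -- Distinct identifiers make the label stored for `f x` unique, so the arbitrary choice in
    -- `NodeState.label` returns the true one.
    obtain rfl := f.injective h1
    rw [trueLabel_apply, NodeState.label, dif_pos hex]
    exact h2.symm
  · intro b
    rw [NodeState.graph, fromRel_adj]
    constructor
    · intro hab
      refine ⟨hab.ne, Or.inl ?_⟩
      obtain ⟨a', y, h, ha', rfl⟩ := (map_adj f G _ _).1 hab
      obtain rfl := f.injective ha'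
      exact knowledge_edges_complete G f ω r hx h
    · rintro ⟨-, h | h⟩
      · exact knowledge_edges_sound G f ω _ v h
      · exact (knowledge_edges_sound G f ω _ v h).symm

lemma result_eq (v : V) : (spannerAlgorithm c).result p G f ω v =
    {i | (clusterSpanner (clusterParams c (knowledge G f ω (horizon c p + 1) v).params)
      (knowledge G f ω (horizon c p + 1) v).graph (knowledge G f ω (horizon c p + 1) v).label
      (Finset.range ((knowledge G f ω (horizon c p + 1) v).params.n + 1))).Adj
        (knowledge G f ω (horizon c p + 1) v).id i} := rfl

/-- The algorithm computes the union of the local spanners of the whole network. -/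
lemma spannerAlgorithm_computes :
    (spannerAlgorithm c).Computes p G f ω
      ((clusterSpanner (clusterParams c p) (G.map f) (trueLabel f ω)
        (Finset.range (p.n + 1))).comap f) := by
  intro v
  have hloc := locallyEqual_knowledge G f ω (horizon c p) v
  ext i
  rw [result_eq, Set.mem_ofPred_eq, knowledge_params, knowledge_id, ← hloc.clusterSpanner_adj_iff (trueLabel_le f ω)
    (knowledge_label_le G f ω _ v)]
  constructor
  · intro h
    obtain ⟨a, u, -, ha, rfl⟩ := (map_adj f G _ _).1 (clusterSpanner_le _ h)
    exact ⟨u, h, rfl⟩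
  · rintro ⟨u, h, rfl⟩
    exact h

lemma one_le_padding (ht : 1 ≤ p.t) : 1 ≤ padding p := by
  unfold padding
  split_ifs
  · exact le_rfl
  · exact ht

/-- The execution succeeds if at every vertex some centre wins by a large margin in some copy. -/
lemma isApproxMinSpanner_of_winsBy [Finite V] (ht : 1 ≤ p.t) (hf : ∀ v, f v ≤ p.n) {α : ℝ}
    (hα : 2 * (numCopies c p.n p.k : ℝ) ≤ α)
    (h : ∀ v, ∃ (i : Fin (numCopies c p.n p.k)) (u : V), WinsBy (2 * padding p + 1)
      (copyRadius c p) (fun w => G.edist w v) (2 * padding p + 1)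
      (fun x => finFunctionFinEquiv.symm (ω x) i) u) :
    IsApproxMinSpanner p.t α G
      ((clusterSpanner (clusterParams c p) (G.map f) (trueLabel f ω)
        (Finset.range (p.n + 1))).comap f) := by
  refine isApproxMinSpanner_comap f G (q := clusterParams c p) (trueLabel_le f ω)
    (one_le_padding ht) ht ?_ (fun v => ?_) hα
  · change p.t ≤ padding p ∨ 2 * ((2 * padding p + 1) * radiusBound p.k) ≤ p.t
    unfold padding
    split_ifs with hR
    · right; omega
    · exact Or.inl le_rfl
  · obtain ⟨i, u, hu⟩ := h v
    refine ⟨i, i.2, f u, Finset.mem_range.2 (Nat.lt_succ_of_le (hf u)), fun z hz => ?_⟩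
    have hlabel : ∀ x, trueLabel f ω (f x) i =
        copyRadius c p (finFunctionFinEquiv.symm (ω x) i) := by
      intro x
      rw [trueLabel_apply]
      exact dif_pos i.2
    refine ball_subset_cluster (s := padding p) ?_ (fun w hw => ?_) hz
    · rw [edist_map]
      exact hu.ne_top (δ := fun w => G.edist w v) (v := v) edist_self
    · by_cases hex : ∃ x, f x = w
      · obtain ⟨x, rfl⟩ := hex
        rw [edist_map, edist_map, hlabel, hlabel]
        exact hu x fun hxu => hw (congrArg f hxu)
      -- Numbers that are not identifiers are isolated in `G.map f`, so as centres they are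
      -- infinitely far from `f v` and cannot compete.
      · rw [edist_map_eq_top f G v fun x hx => hex ⟨x, hx⟩, add_top]
        exact le_top

end Execution

/-! ### Running time, success probability and conclusion -/

lemma rounds_le (c : ℕ) (p : SpannerParams) (hk : 1 ≤ p.k) :
    ((spannerAlgorithm c).rounds p : ℝ) ≤ Real.exp (15 * p.k) := by
  refine le_trans ?_ (radiusBound_sq_le p.k hk)
  have hR : 1 ≤ radiusBound p.k :=
    Nat.one_le_pow _ _ (by have := six_le_lossBase hk; omega)
  have h : horizon c p + 1 ≤ 45 * radiusBound p.k ^ 2 := by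
    change (2 * padding p + 1) * radiusBound p.k + padding p +
      (2 * padding p + 1) * radiusBound p.k + (2 * padding p + 1) * radiusBound p.k + 1 ≤ _
    have hpad : padding p + 1 ≤ 6 * radiusBound p.k := by
      unfold padding
      split_ifs <;> omega
    nlinarith
  exact_mod_cast h

open Classical in
lemma successProb_ge (c : ℕ) {p : SpannerParams} (hn : 2 ≤ p.n) (hk : 1 ≤ p.k) (ht : 1 ≤ p.t)
    {V : Type} [Fintype V] (G : SimpleGraph V) (f : V ↪ ℕ) (hV : Fintype.card V = p.n)
    (hf : ∀ v, f v ≤ p.n) {α : ℝ} (hα : 2 * (numCopies c p.n p.k : ℝ) ≤ α) :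
    1 - 1 / (p.n : ℝ) ^ c ≤
      (spannerAlgorithm c).successProb p G f (IsApproxMinSpanner p.t α G) := by
  obtain ⟨hN, hMN, hsmall⟩ := suitableRatio_geomRatio c hn hk
  set M := (geomRatio c p).1 with hM
  set N := (geomRatio c p).2 with hNdef
  set l := numCopies c p.n p.k with hl
  have hN0 : (0 : ℝ) < N := by exact_mod_cast hN
  have htail : ∀ j < radiusBound p.k,
      ((Finset.univ.filter fun s => j + 1 ≤ copyRadius c p s).card : ℝ) =
        (M / N : ℝ) * (Finset.univ.filter fun s => j ≤ copyRadius c p s).card := by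
    intro j hj
    have h1 := card_le_radiusOfSeed hMN (Nat.succ_le_of_lt hj)
    have h2 := card_le_radiusOfSeed hMN hj.le
    have e1 : (Finset.univ.filter fun s => j + 1 ≤ copyRadius c p s).card =
        N ^ (radiusBound p.k - (j + 1)) * M ^ (j + 1) := h1
    have e2 : (Finset.univ.filter fun s => j ≤ copyRadius c p s).card =
        N ^ (radiusBound p.k - j) * M ^ j := h2
    rw [e1, e2]
    obtain ⟨a, ha⟩ := Nat.exists_eq_add_of_lt hj
    rw [ha, show j + a + 1 - (j + 1) = a by omega, show j + a + 1 - j = a + 1 by omega]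
    push_cast
    field_simp
    ring
  have hcount := card_padded_ge (V := V) (g := 2 * padding p + 1) (by omega) (copyRadius c p)
    (radiusBound p.k) l (p := (M / N : ℝ)) (by positivity)
    (by rw [div_le_one hN0]; exact_mod_cast hMN) htail (fun v w => G.edist w v)
    (fun v => edist_self)
  rw [hV] at hcount
  -- One uniform seed per vertex encodes independent uniform seeds for all copies, so counting
  -- favourable outcomes transfers along `e`.
  let e : (V → Fin ((spannerAlgorithm c).numSeeds p)) ≃ (V → Fin l → Fin (copySeeds c p)) :=
    Equiv.piCongrRight fun _ => finFunctionFinEquiv.symm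
  have hle : (Finset.univ.filter fun ω : V → Fin l → Fin (copySeeds c p) =>
      ∀ v, ∃ i, ∃ u, WinsBy (2 * padding p + 1) (copyRadius c p) (fun w => G.edist w v)
        (2 * padding p + 1) (fun x => ω x i) u).card ≤
      Set.ncard {ω : V → Fin ((spannerAlgorithm c).numSeeds p) | ∃ H : SimpleGraph V,
        (spannerAlgorithm c).Computes p G f ω H ∧ IsApproxMinSpanner p.t α G H} := by
    rw [← Set.ncard_coe_finset, ← Set.ncard_image_of_injective _ e.symm.injective]
    refine Set.ncard_le_ncard ?_ (Set.toFinite _)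
    rintro _ ⟨ω, hω, rfl⟩
    refine ⟨_, spannerAlgorithm_computes G f _,
      isApproxMinSpanner_of_winsBy G f _ ht hf hα fun v => ?_⟩
    obtain ⟨i, u, h⟩ := (Finset.mem_filter.1 hω).2 v
    refine ⟨i, u, ?_⟩
    have hx : (fun x => finFunctionFinEquiv.symm (e.symm ω x) i) = fun x => ω x i := by
      ext x
      change ((finFunctionFinEquiv.symm (finFunctionFinEquiv (ω x)) i : Fin _) : ℕ) = _
      rw [Equiv.symm_apply_apply]
    rw [hx]
    exact h
  have hcard : Fintype.card (V → Fin l → Fin (copySeeds c p)) =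
      Nat.card (V → Fin ((spannerAlgorithm c).numSeeds p)) := by
    rw [Nat.card_eq_fintype_card, Fintype.card_congr e]
  have hpos : (0 : ℝ) < Nat.card (V → Fin ((spannerAlgorithm c).numSeeds p)) := by
    have : Nonempty (Fin ((spannerAlgorithm c).numSeeds p)) :=
      ⟨⟨0, (spannerAlgorithm c).numSeeds_pos p⟩⟩
    exact_mod_cast Nat.card_pos
  unfold DistributedAlgorithm.successProb
  rw [le_div_iff₀ hpos]
  have hle' : ((Finset.univ.filter fun ω : V → Fin l → Fin (copySeeds c p) =>
      ∀ v, ∃ i, ∃ u, WinsBy (2 * padding p + 1) (copyRadius c p) (fun w => G.edist w v)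
        (2 * padding p + 1) (fun x => ω x i) u).card : ℝ) ≤
      Set.ncard {ω : V → Fin ((spannerAlgorithm c).numSeeds p) | ∃ H : SimpleGraph V,
        (spannerAlgorithm c).Computes p G f ω H ∧ IsApproxMinSpanner p.t α G H} := by
    exact_mod_cast hle
  refine le_trans ?_ (hcount.trans (le_trans (le_of_eq (by congr!)) hle'))
  rw [hcard]
  gcongr

theorem mainTheorem10 (c : ℕ) :
    ∃ (a b d : ℝ) (A : DistributedAlgorithm SpannerParams),
      0 < a ∧ 0 < b ∧ 0 < d ∧
      ∀ n t k : ℕ, 1 ≤ n → 1 ≤ t → 1 ≤ k →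
        (A.rounds ⟨n, t, k⟩ : ℝ) ≤ Real.exp (a * k) + b * t ∧
        ∀ (V : Type) [Fintype V] (G : SimpleGraph V) (ident : V → ℕ),
          Fintype.card V = n →
          Function.Injective ident →
          (∀ v : V, 1 ≤ ident v ∧ ident v ≤ n) →
          1 - 1 / (n : ℝ) ^ c ≤
            A.successProb ⟨n, t, k⟩ G ident
              (IsApproxMinSpanner t (d * (n : ℝ) ^ (1 / (k : ℝ))) G) := by
  refine ⟨15, 1, 2 * (32 * (c + 1) + 1), spannerAlgorithm c, by norm_num, by norm_num,
    by positivity, fun n t k hn ht hk => ⟨?_, ?_⟩⟩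
  · have := rounds_le c ⟨n, t, k⟩ hk
    have ht0 : (0 : ℝ) ≤ 1 * t := by positivity
    linarith
  · intro V _ G ident hV hinj hid
    rcases Nat.lt_or_ge n 2 with h | h
    -- For `n = 1` the required probability is zero, so no suitable ratio is needed.
    · obtain rfl : n = 1 := by omega
      simp only [Nat.cast_one, one_pow, div_one, sub_self]
      unfold DistributedAlgorithm.successProb
      positivity
    · refine successProb_ge c (p := ⟨n, t, k⟩) h hk ht G ⟨ident, hinj⟩ hV
        (fun v => (hid v).2) ?_
      have := numCopies_le c hn k
      change 2 * (numCopies c n k : ℝ) ≤ _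
      linarith
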